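/- Let $\alpha>-1/2$, let $d\mu_\alpha(x)=(2\pi)^{\alpha+1}x^{2\alpha+1}\,dx$ on $\mathbb{R}^+=[0,\infty)$, and let $L^p_\alpha=L^p(\mathbb{R}^+,\mu_\alpha)$ (complex-valued functions). For $f\in L^1_\alpha$ the Fourier–Bessel transform is $$\mathcal{F}_\alpha f(y)=\int_0^\infty f(x)\,j_\alpha(2\pi xy)\,d\mu_\alpha(x),\qquad j_\alpha(x)=\frac{1}{2^\alpha}\sum_{n=0}^\infty\frac{(-1)^n}{n!\,\Gamma(n+\alpha+1)}\Big(\frac{x}{2}\Big)^{2n}.$$ For $\varepsilon>0$, a measurable set $S\subset\mathbb{R}^+$ is called $(\varepsilon,\alpha)$-thin if $$\mu_\alpha(S\cap[x,x+1])\le\varepsilon\,\mu_\alpha([x,x+1])\quad(0\le x\le 1)$$ and $$\mu_\alpha\big(S\cap[x,x+\tfrac1x]\big)\le\varepsilon\,\mu_\alpha\big([x,x+\tfrac1x]\big)\quad(x\ge 2).$$ Then $\mathcal{F}_\alpha$ extends by continuity from $L^1_\alpha\cap L^2_\alpha$ to $L^2_\alpha$, and, writing $\mathcal{F}_\alpha$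 also for the extension, there exists $\varepsilon_0>0$ such that for every $0<\varepsilon<\varepsilon_0$ there is a constant $C>0$, depending only on $\varepsilon$ and $\alpha$, such that for all $(\varepsilon,\alpha)$-thin sets $S,\Sigma\subset\mathbb{R}^+$ and all $f\in L^2_\alpha$, $$\|f\|_{L^2_\alpha}\le C\Big(\|f\|_{L^2_\alpha(S^c)}+\|\mathcal{F}_\alpha f\|_{L^2_\alpha(\Sigma^c)}\Big),$$ where $A^c=\mathbb{R}^+\setminus A$. -/

import Mathlib

open MeasureTheory Filter Topology Set
open scoped ENNReal

noncomputable section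

namespace FourierBessel

/-- The measure `dμ_α(x) = (2π)^(α+1) x^(2α+1) dx` on the half-line, as a measure on `ℝ` carried by
`(0, ∞)`. -/
def mu (α : ℝ) : Measure ℝ :=
  (volume.restrict (Ioi 0)).withDensity
    fun x => ENNReal.ofReal ((2 * Real.pi) ^ (α + 1) * x ^ (2 * α + 1))

instance (α : ℝ) : SFinite (mu α) := by
  unfold mu; infer_instance

/-- The normalized Bessel function `j_α(x) = J_α(x) / x^α`, by its power series. -/
def j (α x : ℝ) : ℝ :=
  1 / (2 : ℝ) ^ α *
    ∑' n : ℕ, (-1 : ℝ) ^ n / ((n.factorial : ℝ) * Real.Gamma (n + α + 1)) * (x / 2) ^ (2 * n)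

/-- The Fourier–Bessel transform of an integrable function, as an integral. -/
def transform (α : ℝ) (f : ℝ → ℂ) (y : ℝ) : ℂ :=
  ∫ x, f x * (j α (2 * Real.pi * x * y) : ℂ) ∂(mu α)

/-- `L²_α(ℝ⁺)`. -/
abbrev L2 (α : ℝ) : Type := Lp ℂ 2 (mu α)

/-- The subset `L¹_α ∩ L²_α` of `L²_α`. -/
def L1L2 (α : ℝ) : Set (L2 α) := {h | Integrable h (mu α)}

/-- `g` is the Fourier–Bessel transform of `f` in the `L²` sense: as `h` tends to `f` in `L²_α`
within `L¹_α ∩ L²_α`, the integral transform of `h` tends to `g` in `L²_α`. The norm takes values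
in `[0, ∞]`, so this forces the transform of `h` to be square integrable for `h` near `f`. -/
def IsTransformL2 (α : ℝ) (f g : L2 α) : Prop :=
  Tendsto (fun h : L2 α => eLpNorm (fun y => transform α h y - g y) 2 (mu α))
    (𝓝[L1L2 α] f) (𝓝 0)

open Classical in
/-- The Fourier–Bessel transform on `L²_α`: the extension by continuity of the integral transform
from `L¹_α ∩ L²_α`. The limit is unique by `IsTransformL2.unique` below; the value `0` is a formal
default for the case that there is no limit. -/
def transformL2 (α : ℝ) (f : L2 α) : L2 α :=
  if h : ∃ g, IsTransformL2 α f g then h.choose else 0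

/-- `(ε, α)`-thin subsets of the half-line. -/
def IsThin (ε α : ℝ) (S : Set ℝ) : Prop :=
  (∀ x : ℝ, 0 ≤ x → x ≤ 1 →
    mu α (S ∩ Icc x (x + 1)) ≤ ENNReal.ofReal ε * mu α (Icc x (x + 1))) ∧
  (∀ x : ℝ, 2 ≤ x →
    mu α (S ∩ Icc x (x + 1 / x)) ≤ ENNReal.ofReal ε * mu α (Icc x (x + 1 / x)))

/-! The `L²` transform is well defined. -/

theorem dense_L1L2 (α : ℝ) : Dense (L1L2 α) := by
  refine (Lp.simpleFunc.dense (E := ℂ) (μ := mu α) (p := 2) (by simp)).mono ?_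
  intro h hh
  have h1 := Lp.simpleFunc.memLp ⟨h, hh⟩
  rw [SimpleFunc.memLp_iff_integrable (by simp) (by simp)] at h1
  exact h1.congr (Lp.simpleFunc.toSimpleFunc_eq_toFun ⟨h, hh⟩)

theorem summable_j {α : ℝ} (hα : -1 / 2 < α) (x : ℝ) :
    Summable fun n : ℕ =>
      (-1 : ℝ) ^ n / ((n.factorial : ℝ) * Real.Gamma (n + α + 1)) * (x / 2) ^ (2 * n) := by
  refine Summable.of_norm_bounded_eventually_nat (Real.summable_pow_div_factorial ((x / 2) ^ 2)) ?_
  filter_upwards [eventually_ge_atTop 2] with n hn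
  have hn' : (2 : ℝ) ≤ n := by exact_mod_cast hn
  have hG : 1 ≤ Real.Gamma (n + α + 1) := by
    have := Real.Gamma_strictMonoOn_Ici.monotoneOn (a := 2) (b := (n : ℝ) + α + 1)
      (by simp) (by simp only [mem_Ici]; linarith) (by linarith)
    rwa [Real.Gamma_two] at this
  have hf : (0 : ℝ) < n.factorial := by positivity
  rw [norm_mul, norm_div, norm_pow, norm_neg, norm_one, one_pow, norm_mul, pow_mul,
    Real.norm_of_nonneg hf.le, Real.norm_of_nonneg (by linarith : 0 ≤ Real.Gamma (n + α + 1)),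
    Real.norm_of_nonneg (by positivity : 0 ≤ ((x / 2) ^ 2) ^ n), div_mul_eq_mul_div, one_mul]
  gcongr
  nlinarith

theorem measurable_j {α : ℝ} (hα : -1 / 2 < α) : Measurable (j α) := by
  refine Measurable.const_mul ?_ _
  refine measurable_of_tendsto_metrizable
    (f := fun N x => ∑ n ∈ Finset.range N,
      (-1 : ℝ) ^ n / ((n.factorial : ℝ) * Real.Gamma (n + α + 1)) * (x / 2) ^ (2 * n)) ?_ ?_
  · intro N; fun_prop
  · exact tendsto_pi_nhds.2 fun x => (summable_j hα x).hasSum.tendsto_sum_nat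

theorem aestronglyMeasurable_transform {α : ℝ} (hα : -1 / 2 < α) (h : L2 α) :
    AEStronglyMeasurable (transform α h) (mu α) := by
  have hj : Measurable fun p : ℝ × ℝ => ((j α (2 * Real.pi * p.2 * p.1) : ℝ) : ℂ) :=
    Complex.measurable_ofReal.comp ((measurable_j hα).comp (by fun_prop))
  exact StronglyMeasurable.aestronglyMeasurable (StronglyMeasurable.integral_prod_right'
    (f := fun p : ℝ × ℝ => h p.2 * ((j α (2 * Real.pi * p.2 * p.1) : ℝ) : ℂ))
    (((Lp.stronglyMeasurable h).comp_measurable measurable_snd).mul hj.stronglyMeasurable))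

theorem IsTransformL2.unique {α : ℝ} (hα : -1 / 2 < α) {f g₁ g₂ : L2 α}
    (h₁ : IsTransformL2 α f g₁) (h₂ : IsTransformL2 α f g₂) : g₁ = g₂ := by
  have : (𝓝[L1L2 α] f).NeBot := mem_closure_iff_nhdsWithin_neBot.1 (dense_L1L2 α f)
  have key : eLpNorm (fun y => g₁ y - g₂ y) 2 (mu α) = 0 := by
    refine le_antisymm (ge_of_tendsto (add_zero (0 : ℝ≥0∞) ▸ h₂.add h₁) ?_) bot_le
    refine Eventually.of_forall fun h => ?_
    have hm := aestronglyMeasurable_transform hα h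
    have := eLpNorm_sub_le (p := 2) (hm.sub (Lp.aestronglyMeasurable g₂))
      (hm.sub (Lp.aestronglyMeasurable g₁)) (by norm_num)
    refine le_trans (le_of_eq ?_) this
    congr 1
    ext y
    simp
  replace key := (eLpNorm_eq_zero_iff
    ((Lp.aestronglyMeasurable g₁).sub (Lp.aestronglyMeasurable g₂)) (by simp)).1 key
  refine Lp.ext ?_
  filter_upwards [key] with y hy using sub_eq_zero.1 hy

end FourierBessel

end

/-!
Write `e_s(x) = exp (-π s x²)`. Weber's integral gives the heat kernel of the Bessel operator in
closed form: `𝓕 e_s 𝓕` is an integral operator with the positive kernel `heat α s`, of total mass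
one. Letting `s → 0` yields Plancherel's identity, hence the extension of `𝓕` to `L²`.

The uncertainty estimate compares frequency with position. Since `y² / (ξ² + y²)` is the integral
over `s` of `e_s(ξ) π y² e_s(y)`, the soft cutoff to frequencies below the position has the kernel
`∫ heat α s x y π y² e_s(y) ds`; the complementary cutoff is its conjugate under `𝓕`. That the two
add up to the identity comes from integrating the derivative of `s ↦ ⟨e_s 𝓕 f, 𝓕 (e_s f)⟩`, which
tends to `‖f‖²` at `0` and to `0` at `∞`. The cutoff kernel lives at distance about `1 / y` from the
diagonal, the scale on which thinness is tested, so by a Harnack inequality its rows over an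
`(ε, α)`-thin set are small with `ε`. By the Schur test, `f` on `S` and `𝓕 f` on `Σ` then contribute
only a small part of `‖f‖²`, which is absorbed.
-/

noncomputable section

namespace FourierBessel

open Real
open scoped ComplexConjugate Nat

/-! ### The Bessel–Clifford function -/

/-- The Bessel–Clifford function of order `β - 1`, the entire function `∑ wⁿ / (n! Γ(n + β))`. It is
the common form of the Bessel functions `J` (at `w < 0`) and `I` (at `w > 0`). Mathlib's `1 / 0 = 0`
gives `1 / Γ` its correct value at the poles of `Γ`, so no condition on `β` is needed. -/
def besselClifford (β w : ℝ) : ℝ := ∑' n : ℕ, w ^ n / (n ! * Gamma (n + β))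

theorem one_div_Gamma_eq_div_Gamma_add_one (s : ℝ) : 1 / Gamma s = s / Gamma (s + 1) := by
  rcases eq_or_ne s 0 with rfl | hs
  · simp [Gamma_zero]
  · rw [Gamma_add_one hs, div_mul_cancel_left₀ hs, one_div]

theorem summable_besselClifford (β w : ℝ) :
    Summable fun n : ℕ => w ^ n / (n ! * Gamma (n + β)) := by
  refine Summable.of_norm_bounded_eventually_nat (summable_pow_div_factorial |w|) ?_
  filter_upwards [tendsto_natCast_atTop_atTop.eventually_ge_atTop (2 - β)] with n hn
  have one_le_Gamma : 1 ≤ Gamma (n + β) := by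
    simpa only [Gamma_two] using Gamma_strictMonoOn_Ici.monotoneOn (a := 2) (b := n + β)
      self_mem_Ici (mem_Ici.2 (by linarith)) (by linarith)
  rw [norm_div, norm_pow, norm_mul, norm_natCast,
    norm_of_nonneg (zero_le_one.trans one_le_Gamma), norm_eq_abs]
  gcongr
  exact le_mul_of_one_le_right (by positivity) one_le_Gamma

theorem hasSum_besselClifford (β w : ℝ) :
    HasSum (fun n : ℕ => w ^ n / (n ! * Gamma (n + β))) (besselClifford β w) :=
  (summable_besselClifford β w).hasSum

theorem succ_mul_pow_div_factorial_mul_Gamma (β w : ℝ) (n : ℕ) :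
    (n + 1 : ℕ) * w ^ n / ((n + 1)! * Gamma ((n + 1 : ℕ) + β)) =
      w ^ n / (n ! * Gamma (n + (β + 1))) := by
  rw [Nat.factorial_succ, Nat.cast_mul, mul_assoc, mul_div_mul_left _ _ (by positivity),
    Nat.cast_succ, add_assoc, add_comm 1 β]

theorem hasSum_natCast_mul_pow_pred (β w : ℝ) :
    HasSum (fun n : ℕ => n * w ^ (n - 1) / (n ! * Gamma (n + β))) (besselClifford (β + 1) w) := by
  rw [← hasSum_nat_add_iff' 1]
  simpa only [Finset.range_one, Finset.sum_singleton, CharP.cast_eq_zero, zero_mul, zero_div,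
    sub_zero, Nat.add_sub_cancel, succ_mul_pow_div_factorial_mul_Gamma]
    using hasSum_besselClifford (β + 1) w

theorem hasDerivAt_besselClifford (β w : ℝ) :
    HasDerivAt (besselClifford β) (besselClifford (β + 1) w) w := by
  set R := |w| + 1
  rw [← (hasSum_natCast_mul_pow_pred β w).tsum_eq]
  refine hasDerivAt_tsum_of_isPreconnected (t := Metric.ball (0 : ℝ) R) (y₀ := 0)
    (hasSum_natCast_mul_pow_pred β R).summable.norm Metric.isOpen_ball
    (convex_ball (0 : ℝ) R).isPreconnected (fun n z _ => (hasDerivAt_pow n z).div_const _)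
    (fun n z hz => ?_) (Metric.mem_ball_self (by positivity)) (summable_besselClifford β 0)
    (by simp [R])
  rw [mem_ball_zero_iff] at hz
  simp only [norm_div, norm_mul, norm_pow]
  gcongr
  exact hz.le.trans (le_norm_self R)

@[fun_prop]
theorem continuous_besselClifford (β : ℝ) : Continuous (besselClifford β) :=
  continuous_iff_continuousAt.2 fun w => (hasDerivAt_besselClifford β w).continuousAt

@[fun_prop]
theorem measurable_besselClifford (β : ℝ) : Measurable (besselClifford β) :=
  (continuous_besselClifford β).measurable

theorem besselClifford_recurrence (β w : ℝ) :
    besselClifford β w = β * besselClifford (β + 1) w + w * besselClifford (β + 2) w := by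
  have hsum := ((hasSum_besselClifford (β + 1) w).mul_left β).add
    ((hasSum_natCast_mul_pow_pred (β + 1) w).mul_left w)
  rw [show β + 1 + 1 = β + 2 by ring] at hsum
  refine (hsum.congr_fun fun n => ?_).tsum_eq
  rw [← div_div, div_eq_mul_one_div _ (Gamma _), one_div_Gamma_eq_div_Gamma_add_one, ← add_assoc]
  rcases n with _ | n
  · simp
    ring
  · rw [Nat.add_sub_cancel, pow_succ]
    ring

theorem besselClifford_zero (β : ℝ) : besselClifford β 0 = 1 / Gamma β := by
  rw [besselClifford, tsum_eq_single 0 fun n hn => by simp [hn]]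
  simp

theorem besselClifford_zero_pos {β : ℝ} (hβ : 0 < β) : 0 < besselClifford β 0 := by
  rw [besselClifford_zero]
  exact one_div_pos.2 (Gamma_pos_of_pos hβ)

theorem monotoneOn_besselClifford {β : ℝ} (hβ : 0 < β) :
    MonotoneOn (besselClifford β) (Ici 0) := by
  intro v hv w _ hvw
  refine (summable_besselClifford β v).tsum_le_tsum (fun n => ?_) (summable_besselClifford β w)
  have := Gamma_pos_of_pos (by positivity : 0 < n + β)
  rw [mem_Ici] at hv
  gcongr

theorem besselClifford_pos {β : ℝ} (hβ : 0 < β) {w : ℝ} (hw : 0 ≤ w) : 0 < besselClifford β w :=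
  (besselClifford_zero_pos hβ).trans_le (monotoneOn_besselClifford hβ self_mem_Ici hw hw)

theorem hasDerivAt_besselClifford_sq_sub (β w : ℝ) :
    HasDerivAt (fun w => besselClifford β w ^ 2 - w * besselClifford (β + 1) w ^ 2)
      ((2 * β - 1) * besselClifford (β + 1) w ^ 2) w := by
  have h := ((hasDerivAt_besselClifford β w).fun_pow 2).fun_sub
    ((hasDerivAt_id' w).fun_mul ((hasDerivAt_besselClifford (β + 1) w).fun_pow 2))
  convert! h using 1
  rw [show β + 1 + 1 = β + 2 by ring, besselClifford_recurrence β w]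
  push_cast
  ring

theorem monotone_besselClifford_sq_sub {β : ℝ} (hβ : 1 / 2 ≤ β) :
    Monotone fun w => besselClifford β w ^ 2 - w * besselClifford (β + 1) w ^ 2 := by
  refine monotone_of_hasDerivAt_nonneg (hasDerivAt_besselClifford_sq_sub β) fun w => ?_
  exact mul_nonneg (by linarith) (sq_nonneg _)

theorem abs_besselClifford_le_of_nonpos {β : ℝ} (hβ : 1 / 2 ≤ β) {w : ℝ} (hw : w ≤ 0) :
    |besselClifford β w| ≤ besselClifford β 0 := by
  have := monotone_besselClifford_sq_sub hβ hw
  simp only [zero_mul, sub_zero] at this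
  refine abs_le_of_sq_le_sq ?_ (besselClifford_zero_pos (by linarith)).le
  linarith [mul_nonpos_of_nonpos_of_nonneg hw (sq_nonneg (besselClifford (β + 1) w))]

theorem mul_besselClifford_succ_sq_le {β : ℝ} (hβ : 1 / 2 ≤ β) (z : ℝ) :
    z * besselClifford (β + 1) (z ^ 2) ≤ besselClifford β (z ^ 2) := by
  have := monotone_besselClifford_sq_sub hβ (sq_nonneg z)
  simp only [zero_mul, sub_zero] at this
  refine le_of_sq_le_sq ?_ (besselClifford_pos (by linarith) (sq_nonneg z)).le
  linarith [sq_nonneg (besselClifford β 0), mul_pow z (besselClifford (β + 1) (z ^ 2)) 2]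

theorem antitone_exp_mul_besselClifford {β : ℝ} (hβ : 1 / 2 ≤ β) :
    Antitone fun z => exp (-2 * z) * besselClifford β (z ^ 2) := by
  have hd (z : ℝ) : HasDerivAt (fun z => exp (-2 * z) * besselClifford β (z ^ 2))
      (exp (-2 * z) * (2 * (z * besselClifford (β + 1) (z ^ 2) - besselClifford β (z ^ 2)))) z := by
    have h := ((hasDerivAt_id' z).const_mul (-2)).exp.fun_mul
      ((hasDerivAt_besselClifford β (z ^ 2)).comp z (hasDerivAt_pow 2 z))
    convert! h using 1
    simp only [Function.comp_apply]
    push_cast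
    ring
  refine antitone_of_hasDerivAt_nonpos hd fun z => ?_
  have := mul_besselClifford_succ_sq_le hβ z
  exact mul_nonpos_of_nonneg_of_nonpos (exp_pos _).le (by linarith)

theorem abs_besselClifford_le {β : ℝ} (hβ : 1 / 2 ≤ β) (w : ℝ) :
    |besselClifford β w| ≤ besselClifford β 0 * exp (2 * √|w|) := by
  have hβ' : 0 < β := by linarith
  rcases le_total w 0 with hw | hw
  · exact (abs_besselClifford_le_of_nonpos hβ hw).trans
      (le_mul_of_one_le_right (besselClifford_zero_pos hβ').le (one_le_exp (by positivity)))
  · have := antitone_exp_mul_besselClifford hβ (Real.sqrt_nonneg w)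
    simp only [mul_zero, exp_zero, one_mul, sq_sqrt hw, ne_eq, OfNat.ofNat_ne_zero,
      not_false_eq_true, zero_pow, neg_mul, exp_neg] at this
    rw [abs_of_pos (besselClifford_pos hβ' hw), abs_of_nonneg hw]
    rwa [inv_mul_le_iff₀ (exp_pos _), mul_comm (exp _)] at this

theorem j_eq_besselClifford (α x : ℝ) :
    j α x = 1 / 2 ^ α * besselClifford (α + 1) (-(x / 2) ^ 2) := by
  simp only [j, besselClifford]
  congr 1
  refine tsum_congr fun n => ?_
  rw [neg_pow ((x / 2) ^ 2), pow_mul, add_assoc]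
  ring

/-! ### A double series for the Bessel–Clifford function -/

theorem descPochhammer_smeval_natCast_add_sub_one (n : ℕ) {x : ℝ} (hx : 0 < x) :
    (descPochhammer ℤ n).smeval ((n : ℝ) + x - 1) = Gamma (n + x) / Gamma x := by
  induction n generalizing x with
  | zero => simp [(Gamma_pos_of_pos hx).ne']
  | succ n ih =>
    have ih' := ih (add_pos hx one_pos)
    rw [show (n : ℝ) + (x + 1) - 1 = (n + 1 : ℕ) + x - 1 by push_cast; ring] at ih'
    rw [descPochhammer_succ_right, Polynomial.smeval_mul, ih', Polynomial.smeval_sub,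
      Polynomial.smeval_X, Polynomial.smeval_natCast, Gamma_add_one hx.ne', ← add_assoc,
      show (n : ℝ) + x + 1 = (n + 1 : ℕ) + x by push_cast; ring]
    have := Gamma_pos_of_pos hx
    simp only [pow_one, nsmul_eq_mul, pow_zero, mul_one, Nat.cast_succ]
    field_simp
    ring

-- The Chu–Vandermonde identity for falling factorials at the arguments `m` and `n + β - 1`.
theorem sum_choose_mul_descFactorial_mul_Gamma_div {β : ℝ} (hβ : 0 < β) (m n : ℕ) :
    ∑ k ∈ Finset.range (n + 1), n.choose k * (m.descFactorial k * (Gamma (n + β) / Gamma (k + β))) =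
      Gamma (n + (m + β)) / Gamma (m + β) := by
  rw [← descPochhammer_smeval_natCast_add_sub_one n (by positivity : 0 < m + β),
    show (n : ℝ) + (m + β) - 1 = m + (n + β - 1) by ring,
    Ring.descPochhammer_smeval_add n (Commute.all _ _),
    Finset.Nat.sum_antidiagonal_eq_sum_range_succ_mk]
  refine Finset.sum_congr rfl fun k hk => ?_
  have hkn : k ≤ n := Nat.lt_succ_iff.1 (Finset.mem_range.1 hk)
  have h := descPochhammer_smeval_natCast_add_sub_one (n - k) (by positivity : 0 < k + β)
  rw [← add_assoc, ← Nat.cast_add, Nat.sub_add_cancel hkn] at h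
  simp only [h, Polynomial.descPochhammer_smeval_eq_descFactorial]

theorem sum_one_div_factorial_mul_Gamma {β : ℝ} (hβ : 0 < β) (m n : ℕ) :
    ∑ k ∈ Finset.range (min m n + 1), 1 / (k ! * Gamma (k + β) * (m - k)! * (n - k)!) =
      Gamma (m + n + β) / (m ! * Gamma (m + β) * (n ! * Gamma (n + β))) := by
  have (k : ℕ) : Gamma (k + β) ≠ 0 := (Gamma_pos_of_pos (by positivity)).ne'
  have hsubset : Finset.range (min m n + 1) ⊆ Finset.range (n + 1) :=
    Finset.range_subset_range.2 (by lia)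
  have hchu := sum_choose_mul_descFactorial_mul_Gamma_div hβ m n
  rw [← Finset.sum_subset hsubset] at hchu
  · rw [show (m : ℝ) + n + β = n + (m + β) by ring, mul_comm (m ! : ℝ), mul_assoc,
      ← div_div, ← hchu, Finset.sum_div]
    refine Finset.sum_congr rfl fun k hk => ?_
    have hkn : k ≤ n := by have := Finset.mem_range.1 hk; lia
    have hkm : k ≤ m := by have := Finset.mem_range.1 hk; lia
    rw [Nat.cast_choose ℝ hkn, ← Nat.factorial_mul_descFactorial hkm, Nat.cast_mul]
    have : (m.descFactorial k : ℝ) ≠ 0 := by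
      exact_mod_cast (Nat.descFactorial_pos.2 hkm).ne'
    field_simp
  · intro k hkn hkm
    simp only [Finset.mem_range] at hkn hkm
    simp [Nat.descFactorial_eq_zero_iff_lt.2 (by lia : m < k)]

theorem preimage_add_add_singleton (m n : ℕ) :
    (fun t : ℕ × ℕ × ℕ => (t.1 + t.2.1, t.1 + t.2.2)) ⁻¹' {(m, n)} =
      (Finset.range (min m n + 1)).image fun k => (k, m - k, n - k) := by
  ext ⟨k, p, q⟩
  simp only [mem_preimage, mem_singleton_iff, Prod.mk.injEq, Finset.coe_image, Finset.coe_range,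
    mem_image, mem_Iio]
  constructor
  · rintro ⟨rfl, rfl⟩
    exact ⟨k, by lia, rfl, by lia, by lia⟩
  · rintro ⟨_, _, rfl, rfl, rfl⟩
    lia

theorem hasSum_pow_div_factorial (a : ℝ) : HasSum (fun n : ℕ => a ^ n / n !) (exp a) :=
  exp_eq_exp_ℝ ▸ NormedSpace.expSeries_div_hasSum_exp a

-- Group the triple product of `besselClifford β (a r)`, `exp a` and `exp r` by the exponents of `a`
-- and `r`.
theorem hasSum_exp_add_mul_besselClifford {β : ℝ} (hβ : 0 < β) (a r : ℝ) :
    HasSum (fun t : ℕ × ℕ => a ^ t.1 * r ^ t.2 * (Gamma (t.1 + t.2 + β) /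
        (t.1 ! * Gamma (t.1 + β) * (t.2 ! * Gamma (t.2 + β)))))
      (exp (a + r) * besselClifford β (a * r)) := by
  have ha := hasSum_pow_div_factorial a
  have hr := hasSum_pow_div_factorial r
  have hB := hasSum_besselClifford β (a * r)
  have har_summable := summable_mul_of_summable_norm ha.summable.norm hr.summable.norm
  have htriple := hB.mul (ha.mul hr har_summable)
    (summable_mul_of_summable_norm hB.summable.norm har_summable.norm)
  rw [exp_add, mul_comm]
  refine (htriple.tsum_fiberwise fun t => (t.1 + t.2.1, t.1 + t.2.2)).congr_fun fun ⟨m, n⟩ => ?_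
  rw [preimage_add_add_singleton, Finset.tsum_subtype' _ fun t : ℕ × ℕ × ℕ =>
      (a * r) ^ t.1 / (t.1 ! * Gamma (t.1 + β)) * (a ^ t.2.1 / t.2.1 ! * (r ^ t.2.2 / t.2.2 !)),
    Finset.sum_image fun k _ k' _ h => (Prod.mk.inj h).1,
    ← sum_one_div_factorial_mul_Gamma hβ, Finset.mul_sum]
  refine Finset.sum_congr rfl fun k hk => ?_
  have := Finset.mem_range.1 hk
  rw [mul_pow, ← Nat.add_sub_of_le (by lia : k ≤ m), ← Nat.add_sub_of_le (by lia : k ≤ n)]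
  simp only [Nat.add_sub_cancel_left, pow_add]
  ring

/-! ### Gaussian integrals -/

theorem ae_mu_pos (α : ℝ) : ∀ᵐ x ∂mu α, 0 < x :=
  (withDensity_absolutelyContinuous _ _).ae_le (ae_restrict_mem measurableSet_Ioi)

theorem integrable_mu_iff {α : ℝ} {f : ℝ → ℝ} :
    Integrable f (mu α) ↔
      IntegrableOn (fun x => (2 * π) ^ (α + 1) * x ^ (2 * α + 1) * f x) (Ioi 0) := by
  rw [mu, integrable_withDensity_iff_integrable_smul' (by fun_prop)
    (Eventually.of_forall fun x => ENNReal.ofReal_lt_top)]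
  refine integrableOn_congr_fun (fun x hx => ?_) measurableSet_Ioi
  have : 0 ≤ x := (mem_Ioi.1 hx).le
  rw [smul_eq_mul, ENNReal.toReal_ofReal (by positivity)]

theorem integral_mu (α : ℝ) (f : ℝ → ℝ) :
    ∫ x, f x ∂mu α = ∫ x in Ioi 0, (2 * π) ^ (α + 1) * x ^ (2 * α + 1) * f x := by
  rw [mu, integral_withDensity_eq_integral_toReal_smul (by fun_prop)
    (Eventually.of_forall fun x => ENNReal.ofReal_lt_top)]
  refine setIntegral_congr_fun measurableSet_Ioi fun x hx => ?_
  have : 0 ≤ x := (mem_Ioi.1 hx).le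
  rw [smul_eq_mul, ENNReal.toReal_ofReal (by positivity)]

theorem density_mul_pow_mul_exp (α b : ℝ) (n : ℕ) {x : ℝ} (hx : 0 < x) :
    (2 * π) ^ (α + 1) * x ^ (2 * α + 1) * (x ^ (2 * n) * exp (-b * x ^ 2)) =
      (2 * π) ^ (α + 1) * (x ^ (2 * α + 1 + (2 * n : ℕ)) * exp (-b * x ^ (2 : ℝ))) := by
  rw [rpow_add hx (2 * α + 1), rpow_natCast, rpow_ofNat]
  ring

section Gaussian

variable {α b : ℝ}

theorem integrable_pow_mul_exp (hα : -1 < α) (hb : 0 < b) (n : ℕ) :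
    Integrable (fun x => x ^ (2 * n) * exp (-b * x ^ 2)) (mu α) := by
  have h := (integrableOn_rpow_mul_exp_neg_mul_rpow (p := 2) (s := 2 * α + 1 + (2 * n : ℕ)) (b := b)
    (by push_cast; linarith [n.cast_nonneg (α := ℝ)]) (by norm_num) hb).const_mul
    ((2 * π) ^ (α + 1))
  exact integrable_mu_iff.2 (IntegrableOn.congr_fun h
    (fun x hx => (density_mul_pow_mul_exp α b n hx).symm) measurableSet_Ioi)

/-- The mass of `exp (-b x ^ 2)` for `mu α`, divided by `Γ (α + 1)`. -/
def gaussMass (α b : ℝ) : ℝ := 2 ^ α * (π / b) ^ (α + 1)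

theorem integral_pow_mul_exp (hα : -1 < α) (hb : 0 < b) (n : ℕ) :
    ∫ x, x ^ (2 * n) * exp (-b * x ^ 2) ∂mu α =
      gaussMass α b * (Gamma (n + (α + 1)) / b ^ n) := by
  rw [integral_mu, setIntegral_congr_fun measurableSet_Ioi
      (fun x hx => density_mul_pow_mul_exp α b n hx),
    integral_const_mul, integral_rpow_mul_exp_neg_mul_rpow (by norm_num)
      (by push_cast; linarith [n.cast_nonneg (α := ℝ)]) hb]
  have hexp : (2 * α + 1 + (2 * n : ℕ) + 1) / 2 = (n : ℝ) + (α + 1) := by push_cast; ring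
  rw [neg_div, hexp, gaussMass, rpow_neg hb.le, rpow_add hb, rpow_natCast,
    mul_rpow (by norm_num) pi_pos.le, div_rpow pi_pos.le hb.le,
    rpow_add_one (by norm_num : (2 : ℝ) ≠ 0)]
  have : 0 < b ^ (α + 1) := by positivity
  field_simp

theorem hasSum_integral_pow_mul_exp {ι : Type*} [Countable ι] (hα : -1 < α) (hb : 0 < b)
    {c : ι → ℝ} {n : ι → ℕ} (hc : Summable fun i => |c i| * (Gamma (n i + (α + 1)) / b ^ n i)) :
    HasSum (fun i => gaussMass α b * (c i * (Gamma (n i + (α + 1)) / b ^ n i)))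
      (∫ x, ∑' i, c i * (x ^ (2 * n i) * exp (-b * x ^ 2)) ∂mu α) := by
  have hint (i : ι) (a : ℝ) : ∫ x, a * (x ^ (2 * n i) * exp (-b * x ^ 2)) ∂mu α =
      gaussMass α b * (a * (Gamma (n i + (α + 1)) / b ^ n i)) := by
    rw [integral_const_mul, integral_pow_mul_exp hα hb, mul_left_comm]
  have hnorm (i : ι) (x : ℝ) : ‖c i * (x ^ (2 * n i) * exp (-b * x ^ 2))‖ =
      |c i| * (x ^ (2 * n i) * exp (-b * x ^ 2)) := by
    rw [norm_mul, norm_eq_abs,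
      norm_of_nonneg (mul_nonneg (by rw [pow_mul]; positivity) (exp_pos _).le)]
  have h := hasSum_integral_of_summable_integral_norm
    (fun i => (integrable_pow_mul_exp hα hb (n i)).const_mul (c i))
    (by simpa only [hnorm, hint] using hc.mul_left _)
  simpa only [hint] using h

theorem integral_exp_mul_besselClifford_mul_besselClifford (hα : -1 < α) (hb : 0 < b) (A B : ℝ) :
    ∫ x, exp (-b * x ^ 2) * besselClifford (α + 1) (A * x ^ 2) *
        besselClifford (α + 1) (B * x ^ 2) ∂mu α =
      gaussMass α b * (exp (A / b + B / b) * besselClifford (α + 1) (A / b * (B / b))) := by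
  have hβ : 0 < α + 1 := by linarith
  have hΓ (k : ℕ) : 0 < Gamma (k + (α + 1)) := Gamma_pos_of_pos (by positivity)
  let c (t : ℕ × ℕ) : ℝ := A ^ t.1 / (t.1 ! * Gamma (t.1 + (α + 1))) *
    (B ^ t.2 / (t.2 ! * Gamma (t.2 + (α + 1))))
  have hterm (A B : ℝ) (t : ℕ × ℕ) :
      A ^ t.1 / (t.1 ! * Gamma (t.1 + (α + 1))) * (B ^ t.2 / (t.2 ! * Gamma (t.2 + (α + 1)))) *
        (Gamma ((t.1 + t.2 : ℕ) + (α + 1)) / b ^ (t.1 + t.2)) =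
      (A / b) ^ t.1 * (B / b) ^ t.2 * (Gamma (t.1 + t.2 + (α + 1)) /
        (t.1 ! * Gamma (t.1 + (α + 1)) * (t.2 ! * Gamma (t.2 + (α + 1))))) := by
    rw [Nat.cast_add, pow_add, div_pow, div_pow]
    ring
  have habs (t : ℕ × ℕ) : |c t| = |A| ^ t.1 / (t.1 ! * Gamma (t.1 + (α + 1))) *
      (|B| ^ t.2 / (t.2 ! * Gamma (t.2 + (α + 1)))) := by
    simp only [c, abs_mul, abs_div, abs_pow, Nat.abs_cast, abs_of_pos (hΓ _)]
  have h := hasSum_integral_pow_mul_exp hα hb (c := c) (n := fun t => t.1 + t.2) (by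
    simpa only [habs, hterm] using
      (hasSum_exp_add_mul_besselClifford hβ (|A| / b) (|B| / b)).summable)
  simp only [c, hterm] at h
  rw [← h.unique ((hasSum_exp_add_mul_besselClifford hβ (A / b) (B / b)).mul_left _)]
  refine integral_congr_ae (Eventually.of_forall fun x => ?_)
  simp only [besselClifford]
  rw [mul_assoc, tsum_mul_tsum_of_summable_norm (summable_besselClifford _ _).norm
    (summable_besselClifford _ _).norm, ← tsum_mul_left]
  refine tsum_congr fun t => ?_
  rw [mul_pow, mul_pow, ← pow_mul, ← pow_mul, mul_add, pow_add]
  ring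

theorem hasSum_natCast_mul_pow_div_factorial (r : ℝ) :
    HasSum (fun n : ℕ => n * (r ^ n / n !)) (r * exp r) := by
  rw [← hasSum_nat_add_iff' 1]
  simp only [Finset.range_one, Finset.sum_singleton, CharP.cast_eq_zero, zero_mul, sub_zero]
  refine ((hasSum_pow_div_factorial r).mul_left r).congr_fun fun n => ?_
  rw [Nat.factorial_succ, pow_succ]
  push_cast
  field_simp

theorem integral_sq_mul_exp_mul_besselClifford (hα : -1 < α) (hb : 0 < b) (B : ℝ) :
    ∫ x, x ^ 2 * exp (-b * x ^ 2) * besselClifford (α + 1) (B * x ^ 2) ∂mu α =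
      gaussMass α b * ((B / b + (α + 1)) * exp (B / b) / b) := by
  have hβ : 0 < α + 1 := by linarith
  have hΓ (k : ℕ) : 0 < Gamma (k + (α + 1)) := Gamma_pos_of_pos (by positivity)
  have hsum (r : ℝ) : HasSum (fun n : ℕ => (n + (α + 1)) * (r ^ n / n !) / b)
      ((r + (α + 1)) * exp r / b) := by
    simpa only [add_mul] using ((hasSum_natCast_mul_pow_div_factorial r).add
      ((hasSum_pow_div_factorial r).mul_left (α + 1))).div_const b
  have hterm (B : ℝ) (n : ℕ) : B ^ n / (n ! * Gamma (n + (α + 1))) *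
      (Gamma ((n + 1 : ℕ) + (α + 1)) / b ^ (n + 1)) = (n + (α + 1)) * ((B / b) ^ n / n !) / b := by
    rw [show ((n + 1 : ℕ) : ℝ) + (α + 1) = n + (α + 1) + 1 by push_cast; ring,
      Gamma_add_one (by positivity), pow_succ, div_pow]
    have := hΓ n
    field_simp
  have h := hasSum_integral_pow_mul_exp hα hb (n := (· + 1))
    (c := fun n => B ^ n / (n ! * Gamma (n + (α + 1)))) (by
      simpa only [abs_div, abs_pow, abs_mul, Nat.abs_cast, abs_of_pos (hΓ _), hterm] using
        (hsum (|B| / b)).summable)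
  simp only [hterm] at h
  rw [← h.unique ((hsum (B / b)).mul_left _)]
  refine integral_congr_ae (Eventually.of_forall fun x => ?_)
  simp only [besselClifford, ← tsum_mul_left]
  refine tsum_congr fun n => ?_
  rw [mul_pow, ← pow_mul, mul_add_one, pow_add]
  ring

theorem exp_mul_abs_besselClifford_le {β : ℝ} (hβ : 1 / 2 ≤ β) (hb : 0 < b) (A : ℝ) {x : ℝ}
    (hx : 0 ≤ x) :
    exp (-b * x ^ 2) * |besselClifford β (A * x ^ 2)| ≤
      besselClifford β 0 * exp (2 * |A| / b) * exp (-(b / 2) * x ^ 2) := by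
  have hsqrt : √|A * x ^ 2| = √|A| * x := by
    rw [abs_mul, abs_of_nonneg (sq_nonneg x), sqrt_mul (abs_nonneg A), sqrt_sq hx]
  have amgm : 2 * (√|A| * x) ≤ 2 * |A| / b + b / 2 * x ^ 2 := by
    rw [div_add' _ _ _ hb.ne', le_div_iff₀ hb]
    linarith [sq_nonneg (2 * √|A| - b * x), sq_sqrt (abs_nonneg A)]
  have := besselClifford_zero_pos (by linarith : 0 < β)
  calc exp (-b * x ^ 2) * |besselClifford β (A * x ^ 2)|
      ≤ exp (-b * x ^ 2) * (besselClifford β 0 * exp (2 * (√|A| * x))) := by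
        rw [← hsqrt]
        gcongr
        exact abs_besselClifford_le hβ (A * x ^ 2)
    _ ≤ exp (-b * x ^ 2) * (besselClifford β 0 * exp (2 * |A| / b + b / 2 * x ^ 2)) := by gcongr
    _ = besselClifford β 0 * exp (2 * |A| / b) * exp (-(b / 2) * x ^ 2) := by
        rw [mul_left_comm, ← exp_add, mul_assoc, ← exp_add]
        ring_nf

theorem integrable_pow_mul_exp_mul_besselClifford (hα : -1 / 2 ≤ α) (hb : 0 < b) (n : ℕ) (A : ℝ) :
    Integrable (fun x => x ^ (2 * n) * exp (-b * x ^ 2) * besselClifford (α + 1) (A * x ^ 2))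
      (mu α) := by
  refine ((integrable_pow_mul_exp (by linarith) (half_pos hb) n).const_mul
    (besselClifford (α + 1) 0 * exp (2 * |A| / b))).mono' (by fun_prop) ?_
  filter_upwards [ae_mu_pos α] with x hx
  have := exp_mul_abs_besselClifford_le (by linarith : 1 / 2 ≤ α + 1) hb A hx.le
  rw [norm_eq_abs, abs_mul, abs_mul, abs_exp, mul_assoc, abs_of_pos (pow_pos hx _)]
  exact (mul_le_mul_of_nonneg_left this (by positivity)).trans_eq (mul_left_comm _ _ _)

end Gaussian

/-! ### The heat kernel -/

section Heat

variable {α s t x y : ℝ}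

theorem j_two_pi_mul (α x y : ℝ) :
    j α (2 * π * x * y) = 1 / 2 ^ α * besselClifford (α + 1) (-(π * y) ^ 2 * x ^ 2) := by
  rw [j_eq_besselClifford]
  congr 2
  ring

theorem j_zero (α : ℝ) : j α 0 = 1 / 2 ^ α * besselClifford (α + 1) 0 := by
  simp [j_eq_besselClifford]

theorem j_zero_pos (hα : -1 < α) : 0 < j α 0 := by
  have := besselClifford_zero_pos (by linarith : 0 < α + 1)
  rw [j_zero]
  positivity

theorem abs_j_le (hα : -1 / 2 ≤ α) (x : ℝ) : |j α x| ≤ j α 0 := by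
  rw [j_eq_besselClifford, j_zero, abs_mul, abs_of_pos (by positivity)]
  gcongr
  exact abs_besselClifford_le_of_nonpos (by linarith) (neg_nonpos.2 (sq_nonneg _))

@[fun_prop]
theorem continuous_j (α : ℝ) : Continuous (j α) := by
  rw [funext (j_eq_besselClifford α)]
  fun_prop

/-- The heat kernel at time `s` of the Bessel operator: the Fourier–Bessel transform turns the
semigroup it generates into multiplication by `gauss s`. -/
def heat (α s x y : ℝ) : ℝ :=
  1 / 2 ^ α * (1 / s) ^ (α + 1) * exp (-(π * (x ^ 2 + y ^ 2) / s)) *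
    besselClifford (α + 1) ((π * x * y / s) ^ 2)

/-- The Gaussian `exp (-π s x ^ 2)`, both a weight on the half-line and a heat multiplier. -/
def gauss (s x : ℝ) : ℝ := exp (-(π * s) * x ^ 2)

theorem gauss_pos (s x : ℝ) : 0 < gauss s x := exp_pos _

theorem gauss_le_one (hs : 0 ≤ s) (x : ℝ) : gauss s x ≤ 1 := by
  rw [gauss, exp_le_one_iff, neg_mul, neg_nonpos]
  positivity

@[fun_prop]
theorem measurable_gauss {δ : Type*} [MeasurableSpace δ] {f g : δ → ℝ} (hf : Measurable f)
    (hg : Measurable g) : Measurable fun a => gauss (f a) (g a) := by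
  unfold gauss
  fun_prop

@[fun_prop]
theorem measurable_heat {δ : Type*} [MeasurableSpace δ] {f g h : δ → ℝ} (hf : Measurable f)
    (hg : Measurable g) (hh : Measurable h) : Measurable fun a => heat α (f a) (g a) (h a) := by
  unfold heat
  fun_prop

theorem heat_comm (α s x y : ℝ) : heat α s x y = heat α s y x := by
  rw [heat, heat, add_comm (x ^ 2), mul_right_comm π x y]

theorem heat_pos (hα : -1 < α) (hs : 0 < s) (x y : ℝ) : 0 < heat α s x y := by
  have := besselClifford_pos (by linarith : 0 < α + 1) (sq_nonneg (π * x * y / s))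
  unfold heat
  positivity

theorem heat_eq_mul_exp_mul_besselClifford (α s x y : ℝ) :
    heat α s x y = 1 / 2 ^ α * (1 / s) ^ (α + 1) * exp (-(π * x ^ 2 / s)) *
      (exp (-(π / s) * y ^ 2) * besselClifford (α + 1) ((π * x / s) ^ 2 * y ^ 2)) := by
  rw [heat, show -(π * (x ^ 2 + y ^ 2) / s) = -(π * x ^ 2 / s) + -(π / s) * y ^ 2 by ring, exp_add,
    show (π * x * y / s) ^ 2 = (π * x / s) ^ 2 * y ^ 2 by ring]
  ring

theorem gaussMass_pi_div (hs : 0 < s) :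
    1 / 2 ^ α * (1 / s) ^ (α + 1) * gaussMass α (π / s) = 1 := by
  have : 0 < s ^ (α + 1) := by positivity
  rw [gaussMass, div_div_cancel₀ pi_ne_zero, div_rpow zero_le_one hs.le, one_rpow]
  field_simp

theorem integral_gauss_mul_j_mul_j (hα : -1 < α) (hs : 0 < s) (y z : ℝ) :
    ∫ x, gauss s x * j α (2 * π * x * y) * j α (2 * π * x * z) ∂mu α = heat α s y z := by
  have exponent : -(π * y) ^ 2 / (π * s) + -(π * z) ^ 2 / (π * s) =
      -(π * (y ^ 2 + z ^ 2) / s) := by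
    field_simp
    ring
  have argument : -(π * y) ^ 2 / (π * s) * (-(π * z) ^ 2 / (π * s)) = (π * y * z / s) ^ 2 := by
    field_simp
  calc ∫ x, gauss s x * j α (2 * π * x * y) * j α (2 * π * x * z) ∂mu α
      = ∫ x, 1 / 2 ^ α * (1 / 2 ^ α) * (exp (-(π * s) * x ^ 2) *
          besselClifford (α + 1) (-(π * y) ^ 2 * x ^ 2) *
          besselClifford (α + 1) (-(π * z) ^ 2 * x ^ 2)) ∂mu α := by
        congr with x
        rw [j_two_pi_mul, j_two_pi_mul, gauss]
        ring
    _ = heat α s y z := by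
        rw [integral_const_mul,
          integral_exp_mul_besselClifford_mul_besselClifford hα (by positivity), exponent, argument,
          gaussMass, heat, div_mul_cancel_left₀ pi_ne_zero, one_div s]
        field_simp

theorem integral_heat_mul_j (hα : -1 < α) (hs : 0 < s) (x z : ℝ) :
    ∫ y, heat α s x y * j α (2 * π * y * z) ∂mu α = gauss s z * j α (2 * π * x * z) := by
  have exponent : -(π * x ^ 2 / s) + ((π * x / s) ^ 2 / (π / s) + -(π * z) ^ 2 / (π / s)) =
      -(π * s) * z ^ 2 := by
    field_simp
    ring
  have argument : (π * x / s) ^ 2 / (π / s) * (-(π * z) ^ 2 / (π / s)) =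
      -(π * z) ^ 2 * x ^ 2 := by
    field_simp
  calc ∫ y, heat α s x y * j α (2 * π * y * z) ∂mu α
      = ∫ y, 1 / 2 ^ α * (1 / s) ^ (α + 1) * exp (-(π * x ^ 2 / s)) * (1 / 2 ^ α) *
          (exp (-(π / s) * y ^ 2) * besselClifford (α + 1) ((π * x / s) ^ 2 * y ^ 2) *
            besselClifford (α + 1) (-(π * z) ^ 2 * y ^ 2)) ∂mu α := by
        congr with y
        rw [j_two_pi_mul, heat_eq_mul_exp_mul_besselClifford α s]
        ring
    _ = 1 / 2 ^ α * (1 / s) ^ (α + 1) * gaussMass α (π / s) * (exp (-(π * x ^ 2 / s)) *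
          exp ((π * x / s) ^ 2 / (π / s) + -(π * z) ^ 2 / (π / s))) *
        (1 / 2 ^ α * besselClifford (α + 1)
          ((π * x / s) ^ 2 / (π / s) * (-(π * z) ^ 2 / (π / s)))) := by
        rw [integral_const_mul,
          integral_exp_mul_besselClifford_mul_besselClifford hα (by positivity)]
        ring
    _ = gauss s z * j α (2 * π * x * z) := by
        rw [gaussMass_pi_div hs, ← exp_add, exponent, argument, one_mul, gauss, j_two_pi_mul]

theorem integral_heat (hα : -1 < α) (hs : 0 < s) (x : ℝ) : ∫ y, heat α s x y ∂mu α = 1 := by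
  have h := integral_heat_mul_j hα hs x 0
  simp only [mul_zero, integral_mul_const] at h
  exact mul_right_cancel₀ (j_zero_pos hα).ne' (by simpa [gauss] using h)

theorem lintegral_heat (hα : -1 < α) (hs : 0 < s) (x : ℝ) :
    ∫⁻ y, ENNReal.ofReal (heat α s x y) ∂mu α = 1 := by
  have h := integral_heat hα hs x
  rw [← ofReal_integral_eq_lintegral_ofReal (.of_integral_ne_zero (by simp [h]))
    (Eventually.of_forall fun y => (heat_pos hα hs x y).le), h, ENNReal.ofReal_one]

theorem lintegral_heat_left (hα : -1 < α) (hs : 0 < s) (y : ℝ) :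
    ∫⁻ x, ENNReal.ofReal (heat α s x y) ∂mu α = 1 := by
  simp only [heat_comm α s _ y, lintegral_heat hα hs]

theorem heat_mul_sq_mul_gauss (hs : 0 < s) (t x y : ℝ) :
    heat α s x y * (y ^ 2 * gauss t y) = 1 / 2 ^ α * (1 / s) ^ (α + 1) * exp (-(π * x ^ 2 / s)) *
      (y ^ 2 * exp (-(π * (1 + s * t) / s) * y ^ 2) *
        besselClifford (α + 1) ((π * x / s) ^ 2 * y ^ 2)) := by
  have exponent : -(π * (1 + s * t) / s) * y ^ 2 = -(π / s) * y ^ 2 + -(π * t) * y ^ 2 := by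
    field_simp
    ring
  rw [heat_eq_mul_exp_mul_besselClifford α s, gauss, exponent, exp_add]
  ring

theorem integral_heat_mul_sq_mul_gauss (hα : -1 < α) (hs : 0 < s) (ht : 0 ≤ t) (x : ℝ) :
    ∫ y, heat α s x y * (y ^ 2 * gauss t y) ∂mu α =
      (1 / (1 + s * t)) ^ (α + 1) / (1 + s * t) * exp (-(π * t * x ^ 2 / (1 + s * t))) *
        ((α + 1) * s / π + x ^ 2 / (1 + s * t)) := by
  have : 0 < 1 + s * t := by positivity
  have mass : (1 / s) ^ (α + 1) * (π / (π * (1 + s * t) / s)) ^ (α + 1) =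
      (1 / (1 + s * t)) ^ (α + 1) := by
    rw [← mul_rpow (by positivity) (by positivity)]
    congr 1
    field_simp
  have exponent : exp (-(π * t * x ^ 2 / (1 + s * t))) = exp (-(π * x ^ 2 / s)) *
      exp ((π * x / s) ^ 2 / (π * (1 + s * t) / s)) := by
    rw [← exp_add]
    congr 1
    field_simp
    ring
  simp only [heat_mul_sq_mul_gauss hs]
  rw [integral_const_mul, integral_sq_mul_exp_mul_besselClifford hα (by positivity), gaussMass,
    exponent, ← mass]
  field_simp
  ring

theorem lintegral_heat_mul_sq_mul_gauss (hα : -1 / 2 ≤ α) (hs : 0 < s) (ht : 0 ≤ t) (x : ℝ) :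
    ∫⁻ y, ENNReal.ofReal (heat α s x y * (y ^ 2 * gauss t y)) ∂mu α =
      ENNReal.ofReal ((1 / (1 + s * t)) ^ (α + 1) / (1 + s * t) *
        exp (-(π * t * x ^ 2 / (1 + s * t))) * ((α + 1) * s / π + x ^ 2 / (1 + s * t))) := by
  have hα' : -1 < α := by linarith
  rw [← integral_heat_mul_sq_mul_gauss hα' hs ht, ofReal_integral_eq_lintegral_ofReal]
  · simpa only [heat_mul_sq_mul_gauss hs, mul_one] using
      (integrable_pow_mul_exp_mul_besselClifford hα (by positivity) 1 _).const_mul _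
  · exact Eventually.of_forall fun y => mul_nonneg (heat_pos hα' hs x y).le
      (mul_nonneg (sq_nonneg y) (gauss_pos t y).le)

theorem heat_eq_exp_sq_sub (α s x y : ℝ) :
    heat α s x y = 1 / 2 ^ α * (1 / s) ^ (α + 1) * exp (-(π * (x - y) ^ 2 / s)) *
      (exp (-2 * (π * x * y / s)) * besselClifford (α + 1) ((π * x * y / s) ^ 2)) := by
  rw [heat, show -(π * (x ^ 2 + y ^ 2) / s) = -(π * (x - y) ^ 2 / s) + -2 * (π * x * y / s) by ring,
    exp_add]
  ring

theorem heat_le (hα : -1 / 2 ≤ α) (hs : 0 < s) (hx : 0 ≤ x) (hy : 0 ≤ y) :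
    heat α s x y ≤ j α 0 * (1 / s) ^ (α + 1) := by
  have anti : exp (-2 * (π * x * y / s)) * besselClifford (α + 1) ((π * x * y / s) ^ 2) ≤
      besselClifford (α + 1) 0 := by
    simpa using antitone_exp_mul_besselClifford (by linarith : 1 / 2 ≤ α + 1)
      (by positivity : 0 ≤ π * x * y / s)
  have := besselClifford_pos (by linarith : 0 < α + 1) (sq_nonneg (π * x * y / s))
  calc heat α s x y
      ≤ 1 / 2 ^ α * (1 / s) ^ (α + 1) * 1 * besselClifford (α + 1) 0 := by
        rw [heat_eq_exp_sq_sub]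
        gcongr
        exact exp_le_one_iff.2 (neg_nonpos.2 (by positivity))
    _ = j α 0 * (1 / s) ^ (α + 1) := by rw [j_zero]; ring

theorem heat_le_heat_two_mul (hα : -1 / 2 ≤ α) (hs : 0 < s) {y' u : ℝ} (hx : 0 ≤ x)
    (hyy : y' ≤ 2 * y) (hu : π * (x - y') ^ 2 / (2 * s) ≤ π * (x - y) ^ 2 / s + u) :
    heat α s x y ≤ 2 ^ (α + 1) * exp u * heat α (2 * s) x y' := by
  have argument_le : π * x * y' / (2 * s) ≤ π * x * y / s := by
    rw [div_le_div_iff₀ (by positivity) hs]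
    nlinarith [(by positivity : 0 ≤ π * x * s)]
  have anti := antitone_exp_mul_besselClifford (by linarith : 1 / 2 ≤ α + 1) argument_le
  simp only at anti
  have := besselClifford_pos (by linarith : 0 < α + 1) (sq_nonneg (π * x * y / s))
  have scale : (1 / s) ^ (α + 1) = 2 ^ (α + 1) * (1 / (2 * s)) ^ (α + 1) := by
    rw [← mul_rpow zero_le_two (by positivity), mul_one_div, div_mul_cancel_left₀ two_ne_zero,
      one_div]
  rw [heat_eq_exp_sq_sub, heat_eq_exp_sq_sub]
  calc _ ≤ 1 / 2 ^ α * (1 / s) ^ (α + 1) * exp (u + -(π * (x - y') ^ 2 / (2 * s))) *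
        (exp (-2 * (π * x * y' / (2 * s))) *
          besselClifford (α + 1) ((π * x * y' / (2 * s)) ^ 2)) := by
        gcongr
        linarith
    _ = _ := by rw [exp_add, scale]; ring

/-- A Harnack inequality: doubling the time pays for moving the second space variable. -/
theorem heat_le_exp_mul_heat (hα : -1 / 2 ≤ α) (hs : 0 < s) {y' : ℝ} (hx : 0 ≤ x)
    (hyy : y' ≤ 2 * y) :
    heat α s x y ≤ 2 ^ (α + 1) * exp (π * (y - y') ^ 2 / s) * heat α (2 * s) x y' := by
  refine heat_le_heat_two_mul hα hs hx hyy ?_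
  rw [← add_div, div_le_div_iff₀ (by positivity) hs]
  nlinarith [mul_nonneg (by positivity : 0 ≤ π * s) (sq_nonneg ((x - y) - (y - y')))]

theorem sq_sub_mul_heat_le (hα : -1 / 2 ≤ α) (hs : 0 < s) (hx : 0 ≤ x) (hy : 0 ≤ y) :
    (x - y) ^ 2 * heat α s x y ≤ 2 ^ (α + 1) * (2 * s / π) * heat α (2 * s) x y := by
  set v := π * (x - y) ^ 2 / (2 * s) with hv
  have heat_le_exp : heat α s x y ≤ 2 ^ (α + 1) * exp (-v) * heat α (2 * s) x y :=
    heat_le_heat_two_mul hα hs hx (by linarith) (by rw [hv]; apply le_of_eq; field_simp; ring)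
  have sq_eq : (x - y) ^ 2 = 2 * s / π * v := by rw [hv]; field_simp
  have := heat_pos (by linarith : -1 < α) (by positivity : 0 < 2 * s) x y
  calc (x - y) ^ 2 * heat α s x y
      ≤ (x - y) ^ 2 * (2 ^ (α + 1) * exp (-v) * heat α (2 * s) x y) := by gcongr
    _ = 2 ^ (α + 1) * (2 * s / π) * (v * exp (-v)) * heat α (2 * s) x y := by rw [sq_eq]; ring
    _ ≤ 2 ^ (α + 1) * (2 * s / π) * 1 * heat α (2 * s) x y := by
        gcongr
        exact (mul_exp_neg_le_exp_neg_one v).trans (exp_le_one_iff.2 (by norm_num))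
    _ = 2 ^ (α + 1) * (2 * s / π) * heat α (2 * s) x y := by rw [mul_one]

end Heat

/-! ### Square-integrable functions -/

section SquareIntegrable

variable {X E : Type*} [MeasurableSpace X] {μ : Measure X} [NormedAddCommGroup E]

theorem enorm_add_sq_le (a b : E) : ‖a + b‖ₑ ^ 2 ≤ 2 * (‖a‖ₑ ^ 2 + ‖b‖ₑ ^ 2) := by
  have h : ‖a + b‖₊ ^ 2 ≤ 2 * (‖a‖₊ ^ 2 + ‖b‖₊ ^ 2) := (by gcongr; exact nnnorm_add_le a b :
    ‖a + b‖₊ ^ 2 ≤ (‖a‖₊ + ‖b‖₊) ^ 2).trans add_sq_le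
  simp only [enorm_eq_nnnorm]
  exact_mod_cast h

theorem ofReal_mul_norm_sq {c : ℝ} (hc : 0 ≤ c) (z : E) :
    ENNReal.ofReal (c * ‖z‖ ^ 2) = ENNReal.ofReal c * ‖z‖ₑ ^ 2 := by
  rw [ENNReal.ofReal_mul hc, ENNReal.ofReal_pow (norm_nonneg z), ofReal_norm]

theorem eLpNorm_two_sq (f : X → E) : eLpNorm f 2 μ ^ 2 = ∫⁻ x, ‖f x‖ₑ ^ 2 ∂μ := by
  simpa using eLpNorm_nnreal_pow_eq_lintegral (f := f) (μ := μ) (p := 2) two_ne_zero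

theorem ofReal_integral_norm_sq {f : X → E} (hf : MemLp f 2 μ) :
    ENNReal.ofReal (∫ x, ‖f x‖ ^ 2 ∂μ) = ∫⁻ x, ‖f x‖ₑ ^ 2 ∂μ := by
  rw [ofReal_integral_eq_lintegral_ofReal
    ((memLp_two_iff_integrable_sq_norm hf.aestronglyMeasurable).1 hf)
    (Eventually.of_forall fun x => sq_nonneg _)]
  simp

end SquareIntegrable

/-! ### The energy form -/

section Energy

variable {α s : ℝ} {f g : ℝ → ℂ}

theorem ae_mu_prod_pos (α : ℝ) : ∀ᵐ p ∂(mu α).prod (mu α), 0 < p.1 ∧ 0 < p.2 :=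
  (Measure.quasiMeasurePreserving_fst.ae (ae_mu_pos α)).and
    (Measure.quasiMeasurePreserving_snd.ae (ae_mu_pos α))

theorem lintegral_prod_heat_mul_fst (hα : -1 < α) (hs : 0 < s) {u : ℝ → ℝ≥0∞} (hu : Measurable u) :
    ∫⁻ p, ENNReal.ofReal (heat α s p.1 p.2) * u p.1 ∂(mu α).prod (mu α) = ∫⁻ x, u x ∂mu α := by
  rw [lintegral_prod _ (by fun_prop)]
  refine lintegral_congr fun x => ?_
  dsimp only
  rw [lintegral_mul_const _ (by fun_prop), lintegral_heat hα hs, one_mul]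

theorem lintegral_prod_heat_mul_snd (hα : -1 < α) (hs : 0 < s) {u : ℝ → ℝ≥0∞} (hu : Measurable u) :
    ∫⁻ p, ENNReal.ofReal (heat α s p.1 p.2) * u p.2 ∂(mu α).prod (mu α) = ∫⁻ x, u x ∂mu α := by
  rw [← lintegral_prod_heat_mul_fst hα hs hu, ← lintegral_prod_swap]
  simp only [Prod.fst_swap, Prod.snd_swap, heat_comm]

/-- The Dirichlet-type form `∬ heat(x, y) |f x - f y|²` at time `s`; it measures how far the heat
semigroup at time `s` moves `f`. -/
def energy (α s : ℝ) (f : ℝ → ℂ) : ℝ≥0∞ :=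
  ∫⁻ p, ENNReal.ofReal (heat α s p.1 p.2) * ‖f p.1 - f p.2‖ₑ ^ 2 ∂(mu α).prod (mu α)

theorem energy_le (hα : -1 < α) (hs : 0 < s) (hf : Measurable f) :
    energy α s f ≤ 4 * ∫⁻ x, ‖f x‖ₑ ^ 2 ∂mu α := by
  calc energy α s f
      ≤ ∫⁻ p, (ENNReal.ofReal (heat α s p.1 p.2) * (2 * ‖f p.1‖ₑ ^ 2) +
          ENNReal.ofReal (heat α s p.1 p.2) * (2 * ‖f p.2‖ₑ ^ 2)) ∂(mu α).prod (mu α) := by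
        refine lintegral_mono fun p => ?_
        simp only [← mul_add]
        gcongr
        simpa [sub_eq_add_neg] using enorm_add_sq_le (f p.1) (-f p.2)
    _ = 4 * ∫⁻ x, ‖f x‖ₑ ^ 2 ∂mu α := by
        rw [lintegral_add_left (by fun_prop),
          lintegral_prod_heat_mul_fst hα hs (u := fun x => 2 * ‖f x‖ₑ ^ 2) (by fun_prop),
          lintegral_prod_heat_mul_snd hα hs (u := fun x => 2 * ‖f x‖ₑ ^ 2) (by fun_prop),
          lintegral_const_mul _ (by fun_prop), ← add_mul]
        norm_num

theorem energy_le_add_energy_sub (α s : ℝ) (hf : Measurable f) (hg : Measurable g) :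
    energy α s f ≤ 2 * (energy α s g + energy α s (f - g)) := by
  unfold energy
  rw [← lintegral_add_left (by fun_prop), ← lintegral_const_mul _ (by fun_prop)]
  refine lintegral_mono fun p => ?_
  rw [← mul_add, mul_left_comm]
  gcongr
  refine le_of_eq_of_le ?_ (enorm_add_sq_le (g p.1 - g p.2) ((f - g) p.1 - (f - g) p.2))
  rw [← add_sub_add_comm, ← Pi.add_apply, ← Pi.add_apply, add_sub_cancel]

theorem lintegral_heat_mul_add_sq_sub_le (hα : -1 / 2 ≤ α) (hs : 0 < s) {η d x : ℝ} (hη : 0 ≤ η)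
    (hd : 0 ≤ d) (hx : 0 ≤ x) :
    ∫⁻ y, ENNReal.ofReal (heat α s x y * (η + d * (x - y) ^ 2)) ∂mu α ≤
      ENNReal.ofReal (η + d * (2 ^ (α + 1) * (2 * s / π))) := by
  have hα' : -1 < α := by linarith
  set c := 2 ^ (α + 1) * (2 * s / π)
  have : 0 ≤ c := by positivity
  calc ∫⁻ y, ENNReal.ofReal (heat α s x y * (η + d * (x - y) ^ 2)) ∂mu α
      ≤ ∫⁻ y, (ENNReal.ofReal η * ENNReal.ofReal (heat α s x y) +
          ENNReal.ofReal (d * c) * ENNReal.ofReal (heat α (2 * s) x y)) ∂mu α := by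
        refine lintegral_mono_ae ((ae_mu_pos α).mono fun y hy => ?_)
        have := heat_pos hα' hs x y
        have := heat_pos hα' (by positivity : 0 < 2 * s) x y
        rw [← ENNReal.ofReal_mul hη, ← ENNReal.ofReal_mul (by positivity),
          ← ENNReal.ofReal_add (by positivity) (by positivity)]
        refine ENNReal.ofReal_le_ofReal ?_
        linarith [mul_le_mul_of_nonneg_left (sq_sub_mul_heat_le hα hs hx hy.le) hd]
    _ = ENNReal.ofReal (η + d * c) := by
        rw [lintegral_add_left (by fun_prop), lintegral_const_mul _ (by fun_prop),
          lintegral_const_mul _ (by fun_prop), lintegral_heat hα' hs,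
          lintegral_heat hα' (by positivity), mul_one, mul_one,
          ENNReal.ofReal_add hη (by positivity)]

theorem lintegral_indicator_add_indicator_mul_le {X : Type*} [MeasurableSpace X] {μ : Measure X}
    [SFinite μ] {w : X → X → ℝ≥0∞} (hw : Measurable w.uncurry) (w_comm : ∀ x y, w x y = w y x)
    {C : ℝ≥0∞} (hC : ∀ᵐ x ∂μ, ∫⁻ y, w x y ∂μ ≤ C) {K : Set X} (hK : MeasurableSet K) :
    ∫⁻ p, (K.indicator 1 p.1 + K.indicator 1 p.2) * w p.1 p.2 ∂μ.prod μ ≤ 2 * (C * μ K) := by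
  have hwm : Measurable fun p : X × X => K.indicator 1 p.1 * w p.1 p.2 :=
    ((measurable_one.indicator hK).comp measurable_fst).mul hw
  have half : ∫⁻ p, K.indicator 1 p.1 * w p.1 p.2 ∂μ.prod μ ≤ C * μ K := by
    rw [lintegral_prod _ hwm.aemeasurable, ← lintegral_indicator_one hK,
      ← lintegral_const_mul _ (measurable_one.indicator hK)]
    refine lintegral_mono_ae (hC.mono fun x hx => ?_)
    dsimp only
    rw [lintegral_const_mul _ hw.of_uncurry_left, mul_comm]
    gcongr
  simp only [add_mul]
  rw [lintegral_add_left hwm, two_mul]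
  refine add_le_add half (le_of_eq_of_le ?_ half)
  rw [← lintegral_prod_swap]
  simp only [Prod.fst_swap, Prod.snd_swap, w_comm]

theorem energy_le_of_norm_sub_sq_le (hα : -1 / 2 ≤ α) (hs : 0 < s) {K : Set ℝ}
    (hK : MeasurableSet K) (hgK : ∀ x ∉ K, g x = 0) {η d : ℝ} (hη : 0 ≤ η) (hd : 0 ≤ d)
    (hg : ∀ x y, ‖g x - g y‖ ^ 2 ≤ η + d * (x - y) ^ 2) :
    energy α s g ≤ 2 * (ENNReal.ofReal (η + d * (2 ^ (α + 1) * (2 * s / π))) * mu α K) := by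
  let w (x y : ℝ) : ℝ≥0∞ := ENNReal.ofReal (heat α s x y * (η + d * (x - y) ^ 2))
  have w_comm (x y : ℝ) : w x y = w y x := by simp only [w, heat_comm α s x, sub_sq_comm x]
  have le_w (x y : ℝ) : ENNReal.ofReal (heat α s x y) * ‖g x - g y‖ₑ ^ 2 ≤ w x y := by
    have := (heat_pos (by linarith : -1 < α) hs x y).le
    rw [← ofReal_mul_norm_sq this]
    exact ENNReal.ofReal_le_ofReal (mul_le_mul_of_nonneg_left (hg x y) this)
  have le_indicator (x y : ℝ) : ENNReal.ofReal (heat α s x y) * ‖g x - g y‖ₑ ^ 2 ≤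
      (K.indicator 1 x + K.indicator 1 y) * w x y := by
    by_cases hx : x ∈ K
    · rw [indicator_of_mem hx]
      exact (le_w x y).trans (le_mul_of_one_le_left' le_self_add)
    by_cases hy : y ∈ K
    · rw [indicator_of_mem hy]
      exact (le_w x y).trans (le_mul_of_one_le_left' le_add_self)
    · simp [hgK x hx, hgK y hy]
  have hw : Measurable w.uncurry := by
    simp only [w, Function.uncurry_def]
    fun_prop
  calc energy α s g
      ≤ ∫⁻ p, (K.indicator 1 p.1 + K.indicator 1 p.2) * w p.1 p.2 ∂(mu α).prod (mu α) :=
        lintegral_mono fun p => le_indicator p.1 p.2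
    _ ≤ _ := lintegral_indicator_add_indicator_mul_le hw w_comm ((ae_mu_pos α).mono fun x hx =>
        lintegral_heat_mul_add_sq_sub_le hα hs hη hd hx.le) hK

theorem exists_norm_sub_sq_le {E : Type*} [NormedAddCommGroup E] {g : ℝ → E}
    (hg : UniformContinuous g) {M : ℝ} (hM : ∀ x, ‖g x‖ ≤ M) {η : ℝ} (hη : 0 < η) :
    ∃ d, 0 ≤ d ∧ ∀ x y, ‖g x - g y‖ ^ 2 ≤ η + d * (x - y) ^ 2 := by
  obtain ⟨δ, hδ, hδg⟩ := Metric.uniformContinuous_iff.1 hg √η (sqrt_pos.2 hη)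
  refine ⟨(2 * M) ^ 2 / δ ^ 2, by positivity, fun x y => ?_⟩
  rcases lt_or_ge (dist x y) δ with near | far
  · have := pow_le_pow_left₀ (norm_nonneg _) (dist_eq_norm (g x) (g y) ▸ (hδg near).le) 2
    rw [sq_sqrt hη.le] at this
    exact this.trans (le_add_of_nonneg_right (by positivity))
  · have norm_le : ‖g x - g y‖ ≤ 2 * M := by linarith [norm_sub_le (g x) (g y), hM x, hM y]
    have sq_le : δ ^ 2 ≤ (x - y) ^ 2 := by
      rw [← sq_abs (x - y)]
      exact pow_le_pow_left₀ hδ.le far 2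
    calc ‖g x - g y‖ ^ 2 ≤ (2 * M) ^ 2 := pow_le_pow_left₀ (norm_nonneg _) norm_le 2
      _ = (2 * M) ^ 2 / δ ^ 2 * δ ^ 2 := by field_simp
      _ ≤ (2 * M) ^ 2 / δ ^ 2 * (x - y) ^ 2 := by gcongr
      _ ≤ η + (2 * M) ^ 2 / δ ^ 2 * (x - y) ^ 2 := le_add_of_nonneg_left hη.le

theorem isLocallyFiniteMeasure_mu (hα : -1 / 2 ≤ α) : IsLocallyFiniteMeasure (mu α) :=
  IsLocallyFiniteMeasure.withDensity_ofReal
    (continuous_const.mul (continuous_rpow_const (by linarith)))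

theorem tendsto_energy_of_hasCompactSupport (hα : -1 / 2 ≤ α) (hg : Continuous g)
    (hgs : HasCompactSupport g) : Tendsto (fun s => energy α s g) (𝓝[>] 0) (𝓝 0) := by
  have := isLocallyFiniteMeasure_mu hα
  set K := tsupport g
  have hKfin : mu α K ≠ ∞ := hgs.measure_lt_top.ne
  obtain ⟨M, hM⟩ := hg.bounded_above_of_compact_support hgs
  rw [ENNReal.tendsto_nhds_zero]
  intro ε hε
  have bound_tendsto : Tendsto (fun η : ℝ => 2 * (ENNReal.ofReal (η + η) * mu α K)) (𝓝 0) (𝓝 0) :=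
    Continuous.tendsto' ((ENNReal.continuous_const_mul (by simp)).comp
      ((ENNReal.continuous_mul_const hKfin).comp
        (ENNReal.continuous_ofReal.comp (by fun_prop)))) 0 0 (by simp)
  obtain ⟨η, hη, hηε⟩ : ∃ η : ℝ, 0 < η ∧ 2 * (ENNReal.ofReal (η + η) * mu α K) ≤ ε :=
    ((eventually_mem_nhdsWithin (s := Ioi 0)).and
      ((bound_tendsto.mono_left nhdsWithin_le_nhds).eventually_le_const hε)).exists
  obtain ⟨d, hd, hgd⟩ := exists_norm_sub_sq_le (hgs.uniformContinuous_of_continuous hg) hM hη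
  have small : ∀ᶠ s in 𝓝[>] (0 : ℝ), d * (2 ^ (α + 1) * (2 * s / π)) < η :=
    ((Continuous.tendsto' (by fun_prop) 0 0 (by simp)).mono_left
      nhdsWithin_le_nhds).eventually_lt_const hη
  filter_upwards [self_mem_nhdsWithin, small] with s hs hsη
  refine (energy_le_of_norm_sub_sq_le hα hs (isClosed_tsupport g).measurableSet
    (fun x hx => image_eq_zero_of_notMem_tsupport hx) hη.le hd hgd).trans (le_trans ?_ hηε)
  gcongr

theorem tendsto_energy (hα : -1 / 2 ≤ α) (hf : Measurable f) (hf2 : MemLp f 2 (mu α)) :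
    Tendsto (fun s => energy α s f) (𝓝[>] 0) (𝓝 0) := by
  have := isLocallyFiniteMeasure_mu hα
  rw [ENNReal.tendsto_nhds_zero]
  intro ε hε
  have bound_tendsto : Tendsto (fun δ : ℝ≥0∞ => 2 * (δ + 4 * δ ^ 2)) (𝓝 0) (𝓝 0) :=
    Continuous.tendsto' (by fun_prop (disch := simp)) 0 0 (by simp)
  obtain ⟨δ, hδ, hδε⟩ : ∃ δ : ℝ≥0∞, 0 < δ ∧ 2 * (δ + 4 * δ ^ 2) ≤ ε :=
    ((eventually_mem_nhdsWithin (s := Ioi 0)).and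
      ((bound_tendsto.mono_left nhdsWithin_le_nhds).eventually_le_const hε)).exists
  obtain ⟨g, hgs, hfg, hgc, -⟩ := hf2.exists_hasCompactSupport_eLpNorm_sub_le (by simp) hδ.ne'
  filter_upwards [self_mem_nhdsWithin,
    (tendsto_energy_of_hasCompactSupport hα hgc hgs).eventually_le_const hδ] with s hs hsg
  refine (energy_le_add_energy_sub α s hf hgc.measurable).trans (le_trans ?_ hδε)
  gcongr
  refine (energy_le (by linarith) hs (hf.sub hgc.measurable)).trans ?_
  rw [← eLpNorm_two_sq]
  gcongr

end Energy

/-! ### Plancherel's identity and the extension to `L²` -/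

section Plancherel

variable {α s : ℝ} {f g : ℝ → ℂ}

theorem norm_ofReal_j_le (hα : -1 / 2 ≤ α) (x : ℝ) : ‖(j α x : ℂ)‖ ≤ j α 0 := by
  rw [Complex.norm_real]
  exact abs_j_le hα x

theorem transform_congr_ae (hfg : f =ᵐ[mu α] g) : transform α f = transform α g := by
  ext y
  refine integral_congr_ae (hfg.mono fun x hx => ?_)
  simp only [hx]

theorem measurable_transform (hf : AEStronglyMeasurable f (mu α)) : Measurable (transform α f) := by
  rw [transform_congr_ae hf.ae_eq_mk]
  have := hf.stronglyMeasurable_mk.measurable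
  exact (StronglyMeasurable.integral_prod_right'
    (f := fun p : ℝ × ℝ => hf.mk f p.2 * (j α (2 * π * p.2 * p.1) : ℂ))
    (by fun_prop)).measurable

theorem integrable_mul_j (hα : -1 / 2 ≤ α) (hf : Integrable f (mu α)) (y : ℝ) :
    Integrable (fun x => f x * (j α (2 * π * x * y) : ℂ)) (mu α) :=
  hf.mul_bdd (c := j α 0) (by fun_prop) (Eventually.of_forall fun _ => norm_ofReal_j_le hα _)

theorem transform_sub (hα : -1 / 2 ≤ α) (hf : Integrable f (mu α)) (hg : Integrable g (mu α)) :
    transform α (f - g) = transform α f - transform α g := by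
  ext y
  simp only [Pi.sub_apply, transform, sub_mul]
  exact integral_sub (integrable_mul_j hα hf y) (integrable_mul_j hα hg y)

theorem norm_transform_le (hα : -1 / 2 ≤ α) (hf : Integrable f (mu α)) (y : ℝ) :
    ‖transform α f y‖ ≤ j α 0 * ∫ x, ‖f x‖ ∂mu α := by
  rw [mul_comm, ← integral_mul_const]
  refine norm_integral_le_of_norm_le (hf.norm.mul_const _) (Eventually.of_forall fun x => ?_)
  rw [norm_mul]
  gcongr
  exact norm_ofReal_j_le hα _

theorem conj_transform (α : ℝ) (f : ℝ → ℂ) (y : ℝ) :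
    conj (transform α f y) = transform α (fun x => conj (f x)) y := by
  rw [transform, ← integral_conj]
  simp [transform]

theorem integrable_gauss (hα : -1 < α) (hs : 0 < s) : Integrable (gauss s) (mu α) := by
  have := integrable_pow_mul_exp hα (by positivity : 0 < π * s) 0
  simp only [mul_zero, pow_zero, one_mul] at this
  exact this

theorem integrable_conj {X : Type*} [MeasurableSpace X] {ν : Measure X} {u : X → ℂ}
    (hu : Integrable u ν) : Integrable (fun x => conj (u x)) ν :=
  Complex.conjCLE.toContinuousLinearMap.integrable_comp hu

theorem integral_gauss_mul_transform_mul_conj (hα : -1 / 2 ≤ α) (hs : 0 < s)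
    (hf : Integrable f (mu α)) (hg : Integrable g (mu α)) :
    ∫ ξ, (gauss s ξ : ℂ) * (transform α f ξ * conj (transform α g ξ)) ∂mu α =
      ∫ p, (heat α s p.1 p.2 : ℂ) * (f p.1 * conj (g p.2)) ∂(mu α).prod (mu α) := by
  have hα' : -1 < α := by linarith
  have hint : Integrable (fun q : ℝ × ℝ × ℝ => (j α (2 * π * q.2.1 * q.1) : ℂ) *
      (j α (2 * π * q.2.2 * q.1) : ℂ) * ((gauss s q.1 : ℂ) * (f q.2.1 * conj (g q.2.2))))
      ((mu α).prod ((mu α).prod (mu α))) := by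
    have gauss_int : Integrable (fun ξ => (gauss s ξ : ℂ)) (mu α) :=
      (integrable_gauss hα' hs).ofReal
    refine (gauss_int.mul_prod (hf.mul_prod (integrable_conj hg))).bdd_mul
      (c := j α 0 * j α 0) (by fun_prop) (Eventually.of_forall fun q => ?_)
    rw [norm_mul]
    exact mul_le_mul (norm_ofReal_j_le hα _) (norm_ofReal_j_le hα _) (norm_nonneg _)
      (j_zero_pos hα').le
  calc ∫ ξ, (gauss s ξ : ℂ) * (transform α f ξ * conj (transform α g ξ)) ∂mu α
      = ∫ ξ, ∫ p, (j α (2 * π * p.1 * ξ) : ℂ) * (j α (2 * π * p.2 * ξ) : ℂ) *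
          ((gauss s ξ : ℂ) * (f p.1 * conj (g p.2))) ∂(mu α).prod (mu α) ∂mu α := by
        congr with ξ
        rw [conj_transform, transform, transform, ← integral_prod_mul, ← integral_const_mul]
        congr with p
        ring
    _ = ∫ p, ∫ ξ, (j α (2 * π * p.1 * ξ) : ℂ) * (j α (2 * π * p.2 * ξ) : ℂ) *
          ((gauss s ξ : ℂ) * (f p.1 * conj (g p.2))) ∂mu α ∂(mu α).prod (mu α) :=
        integral_integral_swap hint
    _ = ∫ p, (heat α s p.1 p.2 : ℂ) * (f p.1 * conj (g p.2)) ∂(mu α).prod (mu α) := by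
        congr with p
        rw [← integral_gauss_mul_j_mul_j hα' hs, ← integral_complex_ofReal, ← integral_mul_const]
        congr with ξ
        rw [mul_right_comm _ p.1 ξ, mul_right_comm _ p.2 ξ]
        push_cast
        ring

theorem integrable_prod_heat_mul_mul_conj (hα : -1 / 2 ≤ α) (hs : 0 < s)
    (hf : Integrable f (mu α)) (hg : Integrable g (mu α)) :
    Integrable (fun p => (heat α s p.1 p.2 : ℂ) * (f p.1 * conj (g p.2)))
      ((mu α).prod (mu α)) := by
  refine (hf.mul_prod (integrable_conj hg)).bdd_mul (c := j α 0 * (1 / s) ^ (α + 1))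
    (by fun_prop) ?_
  filter_upwards [ae_mu_prod_pos α] with p hp
  rw [Complex.norm_real, norm_of_nonneg (heat_pos (by linarith) hs _ _).le]
  exact heat_le hα hs hp.1.le hp.2.le

theorem integral_prod_re_heat_mul_mul_conj_self (hα : -1 / 2 ≤ α) (hs : 0 < s)
    (hf : Integrable f (mu α)) :
    ∫ p, ((heat α s p.1 p.2 : ℂ) * (f p.1 * conj (f p.2))).re ∂(mu α).prod (mu α) =
      ∫ ξ, gauss s ξ * ‖transform α f ξ‖ ^ 2 ∂mu α := by
  refine (integral_re (integrable_prod_heat_mul_mul_conj hα hs hf hf)).trans ?_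
  rw [← integral_gauss_mul_transform_mul_conj hα hs hf hf,
    ← RCLike.ofReal_re (K := ℂ) (∫ ξ, gauss s ξ * ‖transform α f ξ‖ ^ 2 ∂mu α), ← integral_ofReal]
  congr with ξ
  rw [Complex.mul_conj, Complex.normSq_eq_norm_sq]
  push_cast
  rfl

theorem integrable_prod_heat_mul_norm_sq_fst (hα : -1 < α) (hs : 0 < s) (hf : Measurable f)
    (hf2 : MemLp f 2 (mu α)) :
    Integrable (fun p => heat α s p.1 p.2 * ‖f p.1‖ ^ 2) ((mu α).prod (mu α)) := by
  have hheat (p : ℝ × ℝ) := (heat_pos hα hs p.1 p.2).le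
  refine ⟨by fun_prop, ?_⟩
  rw [hasFiniteIntegral_iff_ofReal
    (Eventually.of_forall fun p => mul_nonneg (hheat p) (sq_nonneg _))]
  simp only [ofReal_mul_norm_sq (hheat _)]
  rw [lintegral_prod_heat_mul_fst hα hs (u := fun x => ‖f x‖ₑ ^ 2) (by fun_prop),
    ← ofReal_integral_norm_sq hf2]
  exact ENNReal.ofReal_lt_top

theorem integral_prod_heat_mul_norm_sq_fst (hα : -1 < α) (hs : 0 < s) (hf : Measurable f)
    (hf2 : MemLp f 2 (mu α)) :
    ∫ p, heat α s p.1 p.2 * ‖f p.1‖ ^ 2 ∂(mu α).prod (mu α) = ∫ x, ‖f x‖ ^ 2 ∂mu α := by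
  rw [integral_prod _ (integrable_prod_heat_mul_norm_sq_fst hα hs hf hf2)]
  simp only [integral_mul_const, integral_heat hα hs, one_mul]

theorem integrable_prod_heat_mul_norm_sq_snd (hα : -1 < α) (hs : 0 < s) (hf : Measurable f)
    (hf2 : MemLp f 2 (mu α)) :
    Integrable (fun p => heat α s p.1 p.2 * ‖f p.2‖ ^ 2) ((mu α).prod (mu α)) := by
  simpa only [Function.comp_def, Prod.fst_swap, Prod.snd_swap, heat_comm] using
    (integrable_prod_heat_mul_norm_sq_fst hα hs hf hf2).swap

theorem integral_prod_heat_mul_norm_sq_snd (hα : -1 < α) (hs : 0 < s) (hf : Measurable f)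
    (hf2 : MemLp f 2 (mu α)) :
    ∫ p, heat α s p.1 p.2 * ‖f p.2‖ ^ 2 ∂(mu α).prod (mu α) = ∫ x, ‖f x‖ ^ 2 ∂mu α := by
  rw [← integral_prod_heat_mul_norm_sq_fst hα hs hf hf2, ← integral_prod_swap]
  simp only [Prod.fst_swap, Prod.snd_swap, heat_comm]

theorem heat_mul_norm_sub_sq (α s : ℝ) (f : ℝ → ℂ) (x y : ℝ) :
    heat α s x y * ‖f x - f y‖ ^ 2 = heat α s x y * ‖f x‖ ^ 2 + heat α s x y * ‖f y‖ ^ 2 -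
      2 * ((heat α s x y : ℂ) * (f x * conj (f y))).re := by
  rw [Complex.re_ofReal_mul, ← Complex.normSq_eq_norm_sq, ← Complex.normSq_eq_norm_sq,
    ← Complex.normSq_eq_norm_sq, Complex.normSq_sub]
  ring

theorem integrable_prod_heat_mul_norm_sub_sq (hα : -1 / 2 ≤ α) (hs : 0 < s) (hfm : Measurable f)
    (hf : Integrable f (mu α)) (hf2 : MemLp f 2 (mu α)) :
    Integrable (fun p => heat α s p.1 p.2 * ‖f p.1 - f p.2‖ ^ 2) ((mu α).prod (mu α)) := by
  have hα' : -1 < α := by linarith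
  simp only [heat_mul_norm_sub_sq]
  exact ((integrable_prod_heat_mul_norm_sq_fst hα' hs hfm hf2).add
    (integrable_prod_heat_mul_norm_sq_snd hα' hs hfm hf2)).sub
    ((integrable_prod_heat_mul_mul_conj hα hs hf hf).re.const_mul 2)

theorem integral_prod_heat_mul_norm_sub_sq (hα : -1 / 2 ≤ α) (hs : 0 < s) (hfm : Measurable f)
    (hf : Integrable f (mu α)) (hf2 : MemLp f 2 (mu α)) :
    ∫ p, heat α s p.1 p.2 * ‖f p.1 - f p.2‖ ^ 2 ∂(mu α).prod (mu α) =
      2 * ∫ x, ‖f x‖ ^ 2 ∂mu α - 2 * ∫ ξ, gauss s ξ * ‖transform α f ξ‖ ^ 2 ∂mu α := by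
  have hα' : -1 < α := by linarith
  have int_fst := integrable_prod_heat_mul_norm_sq_fst hα' hs hfm hf2
  have int_snd := integrable_prod_heat_mul_norm_sq_snd hα' hs hfm hf2
  have int_cross : Integrable
      (fun p => 2 * ((heat α s p.1 p.2 : ℂ) * (f p.1 * conj (f p.2))).re) ((mu α).prod (mu α)) :=
    (integrable_prod_heat_mul_mul_conj hα hs hf hf).re.const_mul 2
  simp only [heat_mul_norm_sub_sq]
  rw [integral_sub (by exact int_fst.add int_snd) int_cross, integral_add int_fst int_snd,
    integral_prod_heat_mul_norm_sq_fst hα' hs hfm hf2,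
    integral_prod_heat_mul_norm_sq_snd hα' hs hfm hf2, integral_const_mul,
    integral_prod_re_heat_mul_mul_conj_self hα hs hf, ← two_mul]

theorem energy_eq_ofReal_integral (hα : -1 / 2 ≤ α) (hs : 0 < s) (hfm : Measurable f)
    (hf : Integrable f (mu α)) (hf2 : MemLp f 2 (mu α)) :
    energy α s f =
      ENNReal.ofReal (∫ p, heat α s p.1 p.2 * ‖f p.1 - f p.2‖ ^ 2 ∂(mu α).prod (mu α)) := by
  have hheat (p : ℝ × ℝ) := (heat_pos (by linarith : -1 < α) hs p.1 p.2).le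
  rw [ofReal_integral_eq_lintegral_ofReal (integrable_prod_heat_mul_norm_sub_sq hα hs hfm hf hf2)
    (Eventually.of_forall fun p => mul_nonneg (hheat p) (sq_nonneg _))]
  simp only [energy, ofReal_mul_norm_sq (hheat _)]

theorem ofReal_integral_gauss_mul_norm_transform_sq (hα : -1 / 2 ≤ α) (hs : 0 < s)
    (hf : Integrable f (mu α)) :
    ENNReal.ofReal (∫ ξ, gauss s ξ * ‖transform α f ξ‖ ^ 2 ∂mu α) =
      ∫⁻ ξ, ENNReal.ofReal (gauss s ξ) * ‖transform α f ξ‖ₑ ^ 2 ∂mu α := by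
  have := measurable_transform hf.aestronglyMeasurable
  have hint : Integrable (fun ξ => gauss s ξ * ‖transform α f ξ‖ ^ 2) (mu α) := by
    refine (integrable_gauss (by linarith) hs).mul_bdd (c := (j α 0 * ∫ x, ‖f x‖ ∂mu α) ^ 2)
      (by fun_prop) (Eventually.of_forall fun ξ => ?_)
    rw [norm_pow, norm_norm]
    gcongr
    exact norm_transform_le hα hf ξ
  rw [ofReal_integral_eq_lintegral_ofReal hint
    (Eventually.of_forall fun ξ => mul_nonneg (gauss_pos _ _).le (sq_nonneg _))]
  simp only [ofReal_mul_norm_sq (gauss_pos _ _).le]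

theorem two_mul_lintegral_gauss_add_energy (hα : -1 / 2 ≤ α) (hs : 0 < s) (hfm : Measurable f)
    (hf : Integrable f (mu α)) (hf2 : MemLp f 2 (mu α)) :
    2 * (∫⁻ ξ, ENNReal.ofReal (gauss s ξ) * ‖transform α f ξ‖ₑ ^ 2 ∂mu α) + energy α s f =
      2 * ∫⁻ x, ‖f x‖ₑ ^ 2 ∂mu α := by
  have hheat (p : ℝ × ℝ) := (heat_pos (by linarith : -1 < α) hs p.1 p.2).le
  have gauss_nonneg : 0 ≤ ∫ ξ, gauss s ξ * ‖transform α f ξ‖ ^ 2 ∂mu α :=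
    integral_nonneg fun ξ => mul_nonneg (gauss_pos s ξ).le (sq_nonneg _)
  have energy_nonneg :
      0 ≤ ∫ p, heat α s p.1 p.2 * ‖f p.1 - f p.2‖ ^ 2 ∂(mu α).prod (mu α) :=
    integral_nonneg fun p => mul_nonneg (hheat p) (sq_nonneg _)
  rw [energy_eq_ofReal_integral hα hs hfm hf hf2, ← ofReal_integral_norm_sq hf2,
    ← ofReal_integral_gauss_mul_norm_transform_sq hα hs hf, ← ENNReal.ofReal_ofNat 2,
    ← ENNReal.ofReal_mul zero_le_two, ← ENNReal.ofReal_mul zero_le_two,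
    ← ENNReal.ofReal_add (by positivity) energy_nonneg,
    integral_prod_heat_mul_norm_sub_sq hα hs hfm hf hf2, add_sub_cancel]

theorem tendsto_lintegral_gauss_mul {u : ℝ → ℝ≥0∞} (hu : Measurable u) (hu' : ∀ x, u x ≠ ∞) :
    Tendsto (fun n : ℕ => ∫⁻ ξ, ENNReal.ofReal (gauss (1 / (n + 1)) ξ) * u ξ ∂mu α) atTop
      (𝓝 (∫⁻ ξ, u ξ ∂mu α)) := by
  refine lintegral_tendsto_of_tendsto_of_monotone (fun n => by fun_prop)
    (Eventually.of_forall fun ξ n m hnm => ?_) (Eventually.of_forall fun ξ => ?_)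
  · simp only [gauss]
    gcongr
  · have gauss_tendsto : Tendsto (fun n : ℕ => gauss (1 / (n + 1)) ξ) atTop (𝓝 (gauss 0 ξ)) :=
      ((by unfold gauss; fun_prop : Continuous fun s => gauss s ξ).tendsto 0).comp
        tendsto_one_div_add_atTop_nhds_zero_nat
    simpa [gauss] using ENNReal.Tendsto.mul_const (b := u ξ)
      (ENNReal.tendsto_ofReal gauss_tendsto) (Or.inr (hu' ξ))

theorem tendsto_one_div_add_one_nhdsGT :
    Tendsto (fun n : ℕ => 1 / ((n : ℝ) + 1)) atTop (𝓝[>] 0) :=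
  tendsto_nhdsWithin_iff.2 ⟨tendsto_one_div_add_atTop_nhds_zero_nat,
    Eventually.of_forall fun n => mem_Ioi.2 (by positivity)⟩

theorem lintegral_enorm_transform_sq (hα : -1 / 2 ≤ α) (hfm : Measurable f)
    (hf : Integrable f (mu α)) (hf2 : MemLp f 2 (mu α)) :
    ∫⁻ ξ, ‖transform α f ξ‖ₑ ^ 2 ∂mu α = ∫⁻ x, ‖f x‖ₑ ^ 2 ∂mu α := by
  have := measurable_transform hf.aestronglyMeasurable
  have gauss_tendsto := ENNReal.Tendsto.const_mul (a := 2) (tendsto_lintegral_gauss_mul (α := α)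
    (u := fun ξ => ‖transform α f ξ‖ₑ ^ 2) (by fun_prop) (by simp)) (Or.inr (by simp))
  have lhs_tendsto := gauss_tendsto.add
    ((tendsto_energy hα hfm hf2).comp tendsto_one_div_add_one_nhdsGT)
  have lhs_eq (n : ℕ) := two_mul_lintegral_gauss_add_energy hα
    (by positivity : 0 < 1 / ((n : ℝ) + 1)) hfm hf hf2
  simp only [Function.comp_apply, lhs_eq, add_zero] at lhs_tendsto
  exact (ENNReal.mul_right_inj (by simp) (by simp)).1
    (tendsto_nhds_unique lhs_tendsto tendsto_const_nhds)

theorem eLpNorm_transform (hα : -1 / 2 ≤ α) (hf : Integrable f (mu α)) (hf2 : MemLp f 2 (mu α)) :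
    eLpNorm (transform α f) 2 (mu α) = eLpNorm f 2 (mu α) := by
  obtain ⟨g, hgm, hfg⟩ := hf.aestronglyMeasurable
  rw [transform_congr_ae hfg, eLpNorm_congr_ae hfg]
  apply (ENNReal.pow_right_strictMono two_ne_zero).injective
  simp only [eLpNorm_two_sq]
  exact lintegral_enorm_transform_sq hα hgm.measurable (hf.congr hfg) (hf2.ae_eq hfg)

theorem memLp_transform (hα : -1 / 2 ≤ α) (hf : Integrable f (mu α)) (hf2 : MemLp f 2 (mu α)) :
    MemLp (transform α f) 2 (mu α) :=
  ⟨(measurable_transform hf.aestronglyMeasurable).aestronglyMeasurable, by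
    rw [eLpNorm_transform hα hf hf2]; exact hf2.eLpNorm_lt_top⟩

theorem isometry_toLp_transform (hα : -1 / 2 ≤ α) :
    Isometry fun h : L1L2 α => (memLp_transform hα h.2 (Lp.memLp (h : L2 α))).toLp := by
  intro h₁ h₂
  rw [Lp.edist_toLp_toLp, ← transform_sub hα h₁.2 h₂.2,
    eLpNorm_transform hα (h₁.2.sub h₂.2) ((Lp.memLp _).sub (Lp.memLp _)), Subtype.edist_eq,
    Lp.edist_def]

theorem exists_isTransformL2 (hα : -1 / 2 ≤ α) (f : L2 α) : ∃ g, IsTransformL2 α f g := by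
  obtain ⟨g, hg⟩ := uniformly_extend_exists isUniformEmbedding_subtype_val.isUniformInducing
    (dense_L1L2 α).denseRange_val (isometry_toLp_transform hα).uniformContinuous f
  refine ⟨g, ?_⟩
  rw [IsTransformL2, nhdsWithin, ← map_comap_setCoe_val, tendsto_map'_iff]
  refine (tendsto_iff_edist_tendsto_0.1 hg).congr fun h => ?_
  rw [Lp.edist_def]
  refine eLpNorm_congr_ae ?_
  filter_upwards [(memLp_transform hα h.2 (Lp.memLp (h : L2 α))).coeFn_toLp] with y hy
  simp [hy]

theorem isTransformL2_transformL2 (hα : -1 / 2 ≤ α) (f : L2 α) :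
    IsTransformL2 α f (transformL2 α f) := by
  rw [transformL2, dif_pos (exists_isTransformL2 hα f)]
  exact (exists_isTransformL2 hα f).choose_spec

end Plancherel

/-! ### Rows and columns of the cutoff kernel -/

section CutoffKernel

theorem lintegral_Ioi_of_hasDerivAt {g g' : ℝ → ℝ} {a l : ℝ}
    (hderiv : ∀ x ∈ Ici a, HasDerivAt g (g' x) x) (hpos : ∀ x ∈ Ioi a, 0 ≤ g' x)
    (hg : Tendsto g atTop (𝓝 l)) :
    ∫⁻ x in Ioi a, ENNReal.ofReal (g' x) = ENNReal.ofReal (l - g a) := by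
  rw [← integral_Ioi_of_hasDerivAt_of_nonneg' hderiv hpos hg, ofReal_integral_eq_lintegral_ofReal
    (integrableOn_Ioi_deriv_of_nonneg' hderiv hpos hg)]
  filter_upwards [ae_restrict_mem measurableSet_Ioi] with x hx using hpos x hx

theorem lintegral_sq_mul_exp_le {c : ℝ} (hc : 0 < c) (x : ℝ) :
    ∫⁻ s in Ioi 0, ENNReal.ofReal (x ^ 2 * exp (-(c * x ^ 2) * s)) ≤ ENNReal.ofReal (1 / c) := by
  rcases eq_or_ne x 0 with rfl | hx
  · simp
  have rate_pos : 0 < c * x ^ 2 := by positivity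
  rw [lintegral_Ioi_of_hasDerivAt (l := 0) (g := fun s => -(1 / c * exp (-(c * x ^ 2) * s)))]
  · simp
  · intro s _
    have hexp : HasDerivAt (fun s => exp (-(c * x ^ 2) * s))
        (exp (-(c * x ^ 2) * s) * (-(c * x ^ 2))) s := by
      simpa using ((hasDerivAt_id' s).const_mul (-(c * x ^ 2))).exp
    convert! (hexp.const_mul (1 / c)).neg using 1
    field_simp
  · intro s _
    positivity
  · have hbot : Tendsto (fun s : ℝ => -(c * x ^ 2) * s) atTop atBot :=
      tendsto_id.const_mul_atTop_of_neg (by linarith)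
    simpa using ((tendsto_exp_atBot.comp hbot).const_mul (1 / c)).neg

theorem lintegral_mul_one_div_rpow_div {β c γ : ℝ} (hβ : 0 < β) (hc : 0 < c) (hγ : 0 < γ) :
    ∫⁻ s in Ioi 0, ENNReal.ofReal (c * s * ((1 / (1 + c * s * (γ * s))) ^ β /
      (1 + c * s * (γ * s)))) = ENNReal.ofReal (1 / (2 * β * γ)) := by
  have denom_pos (s : ℝ) : 0 < 1 + c * s * (γ * s) := by
    rw [show c * s * (γ * s) = c * γ * s ^ 2 by ring]
    positivity
  rw [lintegral_Ioi_of_hasDerivAt (l := 0)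
    (g := fun s => -(1 / (2 * β * γ) * (1 + c * s * (γ * s)) ^ (-β)))]
  · simp
  · intro s _
    have hdenom : HasDerivAt (fun s => 1 + c * s * (γ * s)) (2 * c * γ * s) s := by
      convert! (((hasDerivAt_id' s).const_mul c).mul
        ((hasDerivAt_id' s).const_mul γ)).const_add 1 using 1
      ring
    convert! ((hdenom.rpow_const (p := -β) (Or.inl (denom_pos s).ne')).const_mul
      (1 / (2 * β * γ))).neg using 1
    rw [one_div, inv_rpow (denom_pos s).le, ← rpow_neg (denom_pos s).le,
      rpow_sub_one (denom_pos s).ne']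
    field_simp
  · intro s hs
    have := denom_pos s
    have := mem_Ioi.1 hs
    positivity
  · have htop : Tendsto (fun s : ℝ => 1 + c * s * (γ * s)) atTop atTop :=
      tendsto_atTop_add_const_left _ _
        ((tendsto_id.const_mul_atTop hc).atTop_mul_atTop₀ (tendsto_id.const_mul_atTop hγ))
    simpa using (((tendsto_rpow_neg_atTop hβ).comp htop).const_mul (1 / (2 * β * γ))).neg

variable {α s t x y : ℝ}

theorem mul_exp_neg_le_one (v : ℝ) : v * exp (-v) ≤ 1 := by
  rw [exp_neg, ← div_eq_mul_inv, div_le_one (exp_pos _)]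
  linarith [add_one_le_exp v]

theorem sq_div_mul_exp_le_of_mul_le_one (hs : 0 < s) (ht : 0 < t) (hst : s * t ≤ 1) (x : ℝ) :
    x ^ 2 / (1 + s * t) * exp (-(π * t * x ^ 2 / (1 + s * t))) ≤
      x ^ 2 * exp (-(π * t / 2 * x ^ 2)) := by
  have : 0 < s * t := by positivity
  gcongr
  · exact div_le_self (sq_nonneg x) (by linarith)
  · rw [le_div_iff₀ (by positivity)]
    have : 0 ≤ π * t * x ^ 2 := by positivity
    nlinarith

theorem sq_div_mul_exp_le_of_one_le_mul (hs : 0 < s) (ht : 0 < t) (hst : 1 ≤ s * t) (x : ℝ) :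
    x ^ 2 / (1 + s * t) * exp (-(π * t * x ^ 2 / (1 + s * t))) ≤ s / π := by
  set v := π * t * x ^ 2 / (1 + s * t) with hv
  have sq_div_eq : x ^ 2 / (1 + s * t) = v / (π * t) := by rw [hv]; field_simp
  rw [sq_div_eq, div_mul_eq_mul_div, div_le_div_iff₀ (by positivity) pi_pos]
  have := mul_le_mul_of_nonneg_left ((mul_exp_neg_le_one v).trans hst) pi_pos.le
  linarith

theorem one_div_rpow_div_mul_exp_mul_le (hα : -1 < α) (hs : 0 < s) (ht : 0 < t) (x : ℝ) :
    (1 / (1 + s * t)) ^ (α + 1) / (1 + s * t) * exp (-(π * t * x ^ 2 / (1 + s * t))) *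
        ((α + 1) * s / π + x ^ 2 / (1 + s * t)) ≤
      x ^ 2 * exp (-(π * t / 2 * x ^ 2)) +
        (α + 2) / π * (s * ((1 / (1 + s * t)) ^ (α + 1) / (1 + s * t))) := by
  have hα1 : 0 < α + 1 := by linarith
  have one_le_q : 1 ≤ 1 + s * t := le_add_of_nonneg_right (by positivity)
  have hR : (1 / (1 + s * t)) ^ (α + 1) / (1 + s * t) ≤ 1 :=
    div_le_one_of_le₀ ((rpow_le_one (by positivity)
      (div_le_one_of_le₀ one_le_q (by positivity)) hα1.le).trans one_le_q) (by positivity)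
  have hE : exp (-(π * t * x ^ 2 / (1 + s * t))) ≤ 1 :=
    exp_le_one_iff.2 (neg_nonpos.2 (by positivity))
  have hnear := sq_div_mul_exp_le_of_mul_le_one hs ht (x := x)
  have hfar := sq_div_mul_exp_le_of_one_le_mul hs ht (x := x)
  have hR0 : 0 < (1 / (1 + s * t)) ^ (α + 1) / (1 + s * t) := by positivity
  have hE0 := exp_pos (-(π * t * x ^ 2 / (1 + s * t)))
  set R := (1 / (1 + s * t)) ^ (α + 1) / (1 + s * t)
  set E := exp (-(π * t * x ^ 2 / (1 + s * t)))
  have second_moment : R * (x ^ 2 / (1 + s * t) * E) ≤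
      x ^ 2 * exp (-(π * t / 2 * x ^ 2)) + R * (s / π) := by
    rcases le_total (s * t) 1 with h | h
    · exact (mul_le_of_le_one_left (by positivity) hR).trans
        ((hnear h).trans (le_add_of_nonneg_right (by positivity)))
    · exact (mul_le_mul_of_nonneg_left (hfar h) hR0.le).trans
        (le_add_of_nonneg_left (by positivity))
  calc R * E * ((α + 1) * s / π + x ^ 2 / (1 + s * t))
      = R * ((α + 1) * s / π) * E + R * (x ^ 2 / (1 + s * t) * E) := by ring
    _ ≤ R * ((α + 1) * s / π) * 1 + (x ^ 2 * exp (-(π * t / 2 * x ^ 2)) + R * (s / π)) := by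
        gcongr
    _ = _ := by ring

/-- The kernel `∫₀^∞ heat_{c s}(x, y) y² e^{-π γ s y²} ds`. With `c = γ = 1` it is, up to the factor
`π`, the cutoff kernel; the other scales serve to bound parts of that kernel. -/
def scaledKernel (α c γ x y : ℝ) : ℝ≥0∞ :=
  ∫⁻ s in Ioi 0, ENNReal.ofReal (heat α (c * s) x y * (y ^ 2 * gauss (γ * s) y))

@[fun_prop]
theorem measurable_scaledKernel (α c γ x : ℝ) : Measurable (scaledKernel α c γ x) :=
  Measurable.lintegral_prod_right' (f := fun p : ℝ × ℝ =>
    ENNReal.ofReal (heat α (c * p.2) x p.1 * (p.1 ^ 2 * gauss (γ * p.2) p.1))) (by fun_prop)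

/-- A bound for the rows of `scaledKernel α c 1`, uniform in `c`. -/
def rowConst (α : ℝ) : ℝ := 2 / π + (α + 2) / π * (1 / (2 * (α + 1)))

theorem rowConst_pos (hα : -1 < α) : 0 < rowConst α := by
  have : 0 < α + 1 := by linarith
  have : 0 < α + 2 := by linarith
  unfold rowConst
  positivity

theorem lintegral_scaledKernel_le (hα : -1 / 2 ≤ α) {c γ : ℝ} (hc : 0 < c) (hγ : 0 < γ) (x : ℝ) :
    ∫⁻ y, scaledKernel α c γ x y ∂mu α ≤ ENNReal.ofReal (rowConst α / γ) := by
  have hα1 : 0 < α + 1 := by linarith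
  have hα2 : 0 < α + 2 := by linarith
  simp only [scaledKernel]
  rw [lintegral_lintegral_swap (by fun_prop)]
  calc _ ≤ ∫⁻ s in Ioi (0 : ℝ), (ENNReal.ofReal (x ^ 2 * exp (-(π * γ / 2 * x ^ 2) * s)) +
        ENNReal.ofReal ((α + 2) / π) * ENNReal.ofReal (c * s *
        ((1 / (1 + c * s * (γ * s))) ^ (α + 1) / (1 + c * s * (γ * s))))) := by
        refine setLIntegral_mono' measurableSet_Ioi fun s hs => ?_
        have := mem_Ioi.1 hs
        rw [lintegral_heat_mul_sq_mul_gauss hα (by positivity) (by positivity),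
          ← ENNReal.ofReal_mul (by positivity),
          ← ENNReal.ofReal_add (by positivity) (by positivity)]
        refine ENNReal.ofReal_le_ofReal ((one_div_rpow_div_mul_exp_mul_le (by linarith)
          (by positivity) (by positivity) x).trans (le_of_eq ?_))
        ring_nf
    _ ≤ ENNReal.ofReal (1 / (π * γ / 2)) +
        ENNReal.ofReal ((α + 2) / π) * ENNReal.ofReal (1 / (2 * (α + 1) * γ)) := by
        rw [lintegral_add_left (by fun_prop), lintegral_const_mul _ (by fun_prop),
          lintegral_mul_one_div_rpow_div hα1 hc hγ]
        gcongr
        exact lintegral_sq_mul_exp_le (by positivity) x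
    _ = _ := by
        rw [← ENNReal.ofReal_mul (by positivity),
          ← ENNReal.ofReal_add (by positivity) (by positivity), rowConst]
        congr 1
        field_simp

/-- The kernel `heat_s(x, y) π y² e^{-π s y²}`: multiplication by minus the time derivative of the
Gaussian, followed by the heat flow. -/
def cutoffSlice (α s x y : ℝ) : ℝ≥0∞ :=
  ENNReal.ofReal (heat α s x y * (π * (y ^ 2 * gauss s y)))

/-- The kernel of a soft cutoff to the region of phase space where the frequency is below the
position. -/
def cutoffKernel (α x y : ℝ) : ℝ≥0∞ := ∫⁻ s in Ioi 0, cutoffSlice α s x y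

@[fun_prop]
theorem measurable_cutoffSlice {X : Type*} [MeasurableSpace X] {f g h : X → ℝ} (hf : Measurable f)
    (hg : Measurable g) (hh : Measurable h) :
    Measurable fun a => cutoffSlice α (f a) (g a) (h a) := by
  unfold cutoffSlice
  fun_prop

@[fun_prop]
theorem measurable_cutoffKernel {X : Type*} [MeasurableSpace X] {g h : X → ℝ} (hg : Measurable g)
    (hh : Measurable h) : Measurable fun a => cutoffKernel α (g a) (h a) :=
  Measurable.lintegral_prod_right' (f := fun p : X × ℝ => cutoffSlice α p.2 (g p.1) (h p.1))
    (by fun_prop)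

theorem lintegral_pi_mul_sq_mul_gauss_le (y : ℝ) :
    ∫⁻ s in Ioi 0, ENNReal.ofReal (π * (y ^ 2 * gauss s y)) ≤ 1 := by
  calc _ = ENNReal.ofReal π * ∫⁻ s in Ioi 0, ENNReal.ofReal (y ^ 2 * exp (-(π * y ^ 2) * s)) := by
        rw [← lintegral_const_mul _ (by fun_prop)]
        refine lintegral_congr fun s => ?_
        rw [← ENNReal.ofReal_mul pi_pos.le, gauss]
        ring_nf
    _ ≤ ENNReal.ofReal π * ENNReal.ofReal (1 / π) := by
        gcongr
        exact lintegral_sq_mul_exp_le pi_pos y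
    _ = 1 := by
        rw [← ENNReal.ofReal_mul pi_pos.le, mul_one_div_cancel pi_ne_zero, ENNReal.ofReal_one]

theorem lintegral_cutoffKernel_left_le (hα : -1 < α) (y : ℝ) :
    ∫⁻ x, cutoffKernel α x y ∂mu α ≤ 1 := by
  simp only [cutoffKernel]
  rw [lintegral_lintegral_swap (by fun_prop)]
  refine (setLIntegral_mono' measurableSet_Ioi fun s hs => le_of_eq ?_).trans
    (lintegral_pi_mul_sq_mul_gauss_le y)
  simp only [cutoffSlice, ENNReal.ofReal_mul (heat_pos hα hs _ _).le]
  rw [lintegral_mul_const _ (by fun_prop), lintegral_heat_left hα hs, one_mul]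

theorem cutoffKernel_eq_mul_scaledKernel (α x y : ℝ) :
    cutoffKernel α x y = ENNReal.ofReal π * scaledKernel α 1 1 x y := by
  rw [cutoffKernel, scaledKernel, ← lintegral_const_mul _ (by fun_prop)]
  refine lintegral_congr fun s => ?_
  rw [← ENNReal.ofReal_mul pi_pos.le, cutoffSlice, one_mul]
  ring_nf

theorem lintegral_cutoffKernel_right_le (hα : -1 / 2 ≤ α) (x : ℝ) :
    ∫⁻ y, cutoffKernel α x y ∂mu α ≤ ENNReal.ofReal (π * rowConst α) := by
  simp only [cutoffKernel_eq_mul_scaledKernel]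
  rw [lintegral_const_mul _ (by fun_prop), ENNReal.ofReal_mul pi_pos.le]
  gcongr
  simpa only [div_one] using lintegral_scaledKernel_le hα one_pos one_pos x

end CutoffKernel

/-! ### Rows of the cutoff kernel over thin sets -/

section ThinSets

/-- The points `2 = a₀ < a₁ < …` with `aₙ₊₁ = aₙ + 1 / aₙ`, which cut `[2, ∞)` into intervals of the
kind on which thinness is tested. -/
def grid : ℕ → ℝ
  | 0 => 2
  | n + 1 => grid n + 1 / grid n

theorem two_le_grid (n : ℕ) : 2 ≤ grid n := by
  induction n with
  | zero => exact le_rfl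
  | succ n ih =>
    have : 0 < 1 / grid n := by positivity
    rw [grid]
    linarith

theorem monotone_grid : Monotone grid := by
  refine monotone_nat_of_le_succ fun n => ?_
  have := two_le_grid n
  exact le_add_of_nonneg_right (by positivity)

theorem natCast_le_grid_sq (n : ℕ) : (n : ℝ) ≤ grid n ^ 2 := by
  induction n with
  | zero => simp only [Nat.cast_zero]; positivity
  | succ n ih =>
    have := two_le_grid n
    have : 0 ≤ (1 / grid n) ^ 2 := by positivity
    rw [grid, add_sq, mul_assoc, mul_one_div_cancel (by linarith)]
    push_cast
    linarith

theorem not_bddAbove_range_grid : ¬BddAbove (range grid) := by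
  rintro ⟨M, hM⟩
  obtain ⟨n, hn⟩ := exists_nat_gt (M ^ 2)
  have grid_le : grid n ≤ M := hM ⟨n, rfl⟩
  nlinarith [two_le_grid n, natCast_le_grid_sq n]

theorem iUnion_Ico_grid : ⋃ n, Ico (grid n) (grid (n + 1)) = Ici 2 := by
  simpa [grid] using iUnion_Ico_map_succ_eq_Ici (f := grid) (fun n => monotone_grid bot_le)
    not_bddAbove_range_grid

theorem mu_absolutelyContinuous (α : ℝ) : mu α ≪ volume :=
  (withDensity_absolutelyContinuous _ _).trans Measure.absolutelyContinuous_restrict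

variable {α δ ε s x y y' a : ℝ} {S : Set ℝ} {F G : ℝ → ℝ≥0∞}

theorem IsThin.mono {ε' : ℝ} (hε : ε ≤ ε') (hS : IsThin ε α S) : IsThin ε' α S :=
  ⟨fun x hx hx' => (hS.1 x hx hx').trans (by gcongr), fun x hx => (hS.2 x hx).trans (by gcongr)⟩

theorem IsThin.setLIntegral_inter_Icc_le (hS : IsThin ε α S) (hSm : MeasurableSet S) (ha : 2 ≤ a)
    (hFG : ∀ y ∈ Icc a (a + 1 / a), ∀ y' ∈ Icc a (a + 1 / a), F y ≤ G y') :
    ∫⁻ y in S ∩ Icc a (a + 1 / a), F y ∂mu α ≤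
      ENNReal.ofReal ε * ∫⁻ y in Icc a (a + 1 / a), G y ∂mu α := by
  set I := Icc a (a + 1 / a)
  calc ∫⁻ y in S ∩ I, F y ∂mu α
      ≤ ∫⁻ _ in S ∩ I, (⨅ y' ∈ I, G y') ∂mu α :=
        setLIntegral_mono' (hSm.inter measurableSet_Icc) fun y hy => le_iInf₂ (hFG y hy.2)
    _ = (⨅ y' ∈ I, G y') * mu α (S ∩ I) := setLIntegral_const _ _
    _ ≤ (⨅ y' ∈ I, G y') * (ENNReal.ofReal ε * mu α I) := by
        gcongr
        exact hS.2 a ha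
    _ = ENNReal.ofReal ε * ∫⁻ _ in I, (⨅ y' ∈ I, G y') ∂mu α := by
        rw [setLIntegral_const, mul_left_comm]
    _ ≤ ENNReal.ofReal ε * ∫⁻ y in I, G y ∂mu α := by
        gcongr ENNReal.ofReal ε * ?_
        exact setLIntegral_mono' measurableSet_Icc fun y hy => iInf₂_le y hy

theorem IsThin.setLIntegral_inter_Ici_le (hS : IsThin ε α S) (hSm : MeasurableSet S)
    (hFG : ∀ a, 2 ≤ a → ∀ y ∈ Icc a (a + 1 / a), ∀ y' ∈ Icc a (a + 1 / a), F y ≤ G y') :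
    ∫⁻ y in S ∩ Ici 2, F y ∂mu α ≤ ENNReal.ofReal ε * ∫⁻ y, G y ∂mu α := by
  have hdisj : Pairwise (Function.onFun Disjoint fun n => Ico (grid n) (grid (n + 1))) := by
    simpa using monotone_grid.pairwise_disjoint_on_Ico_succ
  have cell_ae_eq (n : ℕ) :
      Ico (grid n) (grid (n + 1)) =ᵐ[mu α] Icc (grid n) (grid n + 1 / grid n) :=
    (mu_absolutelyContinuous α).ae_eq Ico_ae_eq_Icc
  calc ∫⁻ y in S ∩ Ici 2, F y ∂mu α
      ≤ ∑' n, ∫⁻ y in S ∩ Ico (grid n) (grid (n + 1)), F y ∂mu α := by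
        rw [← iUnion_Ico_grid, inter_iUnion]
        exact lintegral_iUnion_le _ _
    _ ≤ ∑' n, ENNReal.ofReal ε * ∫⁻ y in Ico (grid n) (grid (n + 1)), G y ∂mu α := by
        refine ENNReal.tsum_le_tsum fun n => ?_
        rw [setLIntegral_congr (cell_ae_eq n),
          setLIntegral_congr ((ae_eq_refl S).inter (cell_ae_eq n))]
        exact hS.setLIntegral_inter_Icc_le hSm (two_le_grid n) (hFG _ (two_le_grid n))
    _ = ENNReal.ofReal ε * ∫⁻ y in Ici 2, G y ∂mu α := by
        rw [ENNReal.tsum_mul_left, ← lintegral_iUnion (fun n => measurableSet_Ico) hdisj,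
          iUnion_Ico_grid]
    _ ≤ ENNReal.ofReal ε * ∫⁻ y, G y ∂mu α := by
        gcongr ENNReal.ofReal ε * ?_
        exact setLIntegral_le_lintegral _ _

theorem IsThin.measure_inter_Icc_zero_two_le (hS : IsThin ε α S) :
    mu α (S ∩ Icc 0 2) ≤ ENNReal.ofReal ε * (mu α (Icc 0 1) + mu α (Icc 1 2)) := by
  have h01 := hS.1 0 le_rfl zero_le_one
  have h12 := hS.1 1 zero_le_one le_rfl
  norm_num at h01 h12
  rw [← Icc_union_Icc_eq_Icc (zero_le_one (α := ℝ)) one_le_two, inter_union_distrib_left, mul_add]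
  exact (measure_union_le _ _).trans (add_le_add h01 h12)

theorem one_div_le_div_four (ha : 2 ≤ a) : 1 / a ≤ a / 4 := by
  rw [div_le_iff₀ (by linarith)]
  nlinarith

theorem sq_le_two_mul_sq_of_mem_Icc (ha : 2 ≤ a) (hy : y ∈ Icc a (a + 1 / a)) (hy' : a ≤ y') :
    y ^ 2 ≤ 2 * y' ^ 2 := by
  have := one_div_le_div_four ha
  nlinarith [hy.1, hy.2]

theorem sq_sub_div_le_of_mem_Icc (ha : 2 ≤ a) (hy : y ∈ Icc a (a + 1 / a))
    (hy' : y' ∈ Icc a (a + 1 / a)) (hδ : 0 < δ) (hs : 0 < s) (hsy : δ ≤ s * y ^ 2) :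
    (y - y') ^ 2 / s ≤ 2 / δ := by
  have hdiff : (y - y') ^ 2 ≤ (1 / a) ^ 2 :=
    sq_le_sq' (by linarith [hy.1, hy'.2]) (by linarith [hy.2, hy'.1])
  rw [div_le_div_iff₀ hs hδ]
  calc (y - y') ^ 2 * δ ≤ (1 / a) ^ 2 * (s * (2 * a ^ 2)) := by
        gcongr
        exact hsy.trans (by gcongr; exact sq_le_two_mul_sq_of_mem_Icc ha hy le_rfl)
    _ = 2 * s := by field_simp

/-- The Harnack constant of the cutoff kernel on the intervals `[a, a + 1 / a]`, for times `s` with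
`δ ≤ s y²`. -/
def harnackConst (α δ : ℝ) : ℝ := 2 ^ (α + 1) * exp (π * (2 / δ)) * (2 * π)

theorem cutoffSlice_le_harnackConst_mul (hα : -1 / 2 ≤ α) (hδ : 0 < δ) (hs : 0 < s) (hx : 0 ≤ x)
    (ha : 2 ≤ a) (hy : y ∈ Icc a (a + 1 / a)) (hy' : y' ∈ Icc a (a + 1 / a))
    (hsy : δ ≤ s * y ^ 2) :
    cutoffSlice α s x y ≤ ENNReal.ofReal (harnackConst α δ) *
      ENNReal.ofReal (heat α (2 * s) x y' * (y' ^ 2 * gauss (1 / 2 * s) y')) := by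
  have := heat_pos (by linarith : -1 < α) (by positivity : 0 < 2 * s) x y'
  have := gauss_pos s y
  have := gauss_pos (1 / 2 * s) y'
  have hsub := sq_sub_div_le_of_mem_Icc ha hy hy' hδ hs hsy
  have hyy' : y' ≤ 2 * y := by linarith [hy.1, hy'.2, one_div_le_div_four ha]
  have hgauss : gauss s y ≤ gauss (1 / 2 * s) y' := by
    have hsq := sq_le_two_mul_sq_of_mem_Icc ha hy' hy.1
    have : 0 < π * s := by positivity
    exact exp_le_exp.2 (by nlinarith)
  rw [← ENNReal.ofReal_mul (by unfold harnackConst; positivity), cutoffSlice]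
  refine ENNReal.ofReal_le_ofReal ?_
  calc heat α s x y * (π * (y ^ 2 * gauss s y))
      ≤ (2 ^ (α + 1) * exp (π * (2 / δ)) * heat α (2 * s) x y') *
        (π * (2 * y' ^ 2 * gauss (1 / 2 * s) y')) := by
        gcongr
        · refine (heat_le_exp_mul_heat hα hs hx hyy').trans ?_
          rw [mul_div_assoc]
          gcongr
        · exact sq_le_two_mul_sq_of_mem_Icc ha hy hy'.1
    _ = harnackConst α δ * (heat α (2 * s) x y' * (y' ^ 2 * gauss (1 / 2 * s) y')) := by
        rw [harnackConst]
        ring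

/-- The part of the cutoff kernel coming from the times `s` with `δ ≤ s y²`. -/
def farKernel (α δ x y : ℝ) : ℝ≥0∞ :=
  ∫⁻ s in Ioi 0 ∩ {s | δ ≤ s * y ^ 2}, cutoffSlice α s x y

theorem cutoffSlice_le_of_mul_sq_le (hα : -1 < α) (hδ : 0 < δ) (hs : 0 < s) (hsy : s * y ^ 2 ≤ δ) :
    cutoffSlice α s x y ≤ ENNReal.ofReal (exp π * π) *
      ENNReal.ofReal (heat α (1 * s) x y * (y ^ 2 * gauss (1 / δ * s) y)) := by
  have := heat_pos hα hs x y
  have hgauss : gauss s y ≤ exp π * gauss (1 / δ * s) y := by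
    refine (gauss_le_one hs.le y).trans ?_
    rw [gauss, ← exp_add]
    refine one_le_exp ?_
    have : s * y ^ 2 / δ ≤ 1 := (div_le_one hδ).2 hsy
    rw [show π + -(π * (1 / δ * s)) * y ^ 2 = π * (1 - s * y ^ 2 / δ) by ring]
    exact mul_nonneg pi_pos.le (by linarith)
  rw [← ENNReal.ofReal_mul (by positivity), cutoffSlice]
  refine ENNReal.ofReal_le_ofReal ?_
  calc heat α s x y * (π * (y ^ 2 * gauss s y))
      ≤ heat α s x y * (π * (y ^ 2 * (exp π * gauss (1 / δ * s) y))) := by gcongr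
    _ = exp π * π * (heat α (1 * s) x y * (y ^ 2 * gauss (1 / δ * s) y)) := by ring_nf

theorem cutoffKernel_le_add_farKernel (hα : -1 < α) (hδ : 0 < δ) (x y : ℝ) :
    cutoffKernel α x y ≤
      ENNReal.ofReal (exp π * π) * scaledKernel α 1 (1 / δ) x y + farKernel α δ x y := by
  rw [cutoffKernel, ← sdiff_union_inter (Ioi 0) {s | δ ≤ s * y ^ 2}, scaledKernel,
    ← lintegral_const_mul _ (by fun_prop)]
  refine (lintegral_union_le _ _ _).trans (add_le_add ?_ le_rfl)
  calc ∫⁻ s in Ioi 0 \ {s | δ ≤ s * y ^ 2}, cutoffSlice α s x y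
      ≤ ∫⁻ s in Ioi 0 \ {s | δ ≤ s * y ^ 2}, ENNReal.ofReal (exp π * π) *
          ENNReal.ofReal (heat α (1 * s) x y * (y ^ 2 * gauss (1 / δ * s) y)) :=
        setLIntegral_mono (by fun_prop) fun s hs =>
          cutoffSlice_le_of_mul_sq_le hα hδ hs.1 (not_le.1 hs.2).le
    _ ≤ _ := lintegral_mono_set sdiff_subset

theorem farKernel_le_of_mem_Icc (hα : -1 / 2 ≤ α) (hδ : 0 < δ) (hx : 0 ≤ x) (hy : y ∈ Icc 0 2) :
    farKernel α δ x y ≤ ENNReal.ofReal (j α 0 * (4 / δ) ^ (α + 1)) := by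
  have hβ : 0 < α + 1 := by linarith
  have hj := j_zero_pos (by linarith : -1 < α)
  calc farKernel α δ x y
      ≤ ∫⁻ s in Ioi 0 ∩ {s | δ ≤ s * y ^ 2}, ENNReal.ofReal (j α 0 * (4 / δ) ^ (α + 1)) *
          ENNReal.ofReal (π * (y ^ 2 * gauss s y)) := by
        refine setLIntegral_mono (by fun_prop) fun s ⟨(hs : 0 < s), (hsy : δ ≤ s * y ^ 2)⟩ => ?_
        have time_bound : 1 / s ≤ 4 / δ := by
          rw [div_le_div_iff₀ hs hδ]
          have : y ^ 2 ≤ 4 := by nlinarith [hy.1, hy.2]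
          nlinarith
        rw [cutoffSlice, ENNReal.ofReal_mul (heat_pos (by linarith) hs x y).le]
        gcongr
        refine (heat_le hα hs hx hy.1).trans ?_
        gcongr
    _ ≤ ENNReal.ofReal (j α 0 * (4 / δ) ^ (α + 1)) * 1 := by
        rw [lintegral_const_mul' _ _ ENNReal.ofReal_ne_top]
        gcongr
        exact (lintegral_mono_set inter_subset_left).trans (lintegral_pi_mul_sq_mul_gauss_le y)
    _ = _ := mul_one _

theorem farKernel_le_harnackConst_mul (hα : -1 / 2 ≤ α) (hδ : 0 < δ) (hx : 0 ≤ x) (ha : 2 ≤ a)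
    (hy : y ∈ Icc a (a + 1 / a)) (hy' : y' ∈ Icc a (a + 1 / a)) :
    farKernel α δ x y ≤ ENNReal.ofReal (harnackConst α δ) * scaledKernel α 2 (1 / 2) x y' := by
  rw [scaledKernel, ← lintegral_const_mul' _ _ ENNReal.ofReal_ne_top]
  refine (setLIntegral_mono (by fun_prop) fun s hs => ?_).trans
    (lintegral_mono_set inter_subset_left)
  exact cutoffSlice_le_harnackConst_mul hα hδ hs.1 hx ha hy hy' hs.2

theorem IsThin.setLIntegral_farKernel_inter_Icc_le (hα : -1 / 2 ≤ α) (hS : IsThin ε α S)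
    (hSm : MeasurableSet S) (hδ : 0 < δ) (hx : 0 ≤ x) :
    ∫⁻ y in S ∩ Icc 0 2, farKernel α δ x y ∂mu α ≤ ENNReal.ofReal ε *
      (ENNReal.ofReal (j α 0 * (4 / δ) ^ (α + 1)) * (mu α (Icc 0 1) + mu α (Icc 1 2))) := by
  calc _ ≤ ∫⁻ _ in S ∩ Icc 0 2, ENNReal.ofReal (j α 0 * (4 / δ) ^ (α + 1)) ∂mu α :=
        setLIntegral_mono' (hSm.inter measurableSet_Icc) fun y hy =>
          farKernel_le_of_mem_Icc hα hδ hx hy.2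
    _ = ENNReal.ofReal (j α 0 * (4 / δ) ^ (α + 1)) * mu α (S ∩ Icc 0 2) := setLIntegral_const _ _
    _ ≤ _ := by
        rw [mul_left_comm]
        gcongr
        exact hS.measure_inter_Icc_zero_two_le

theorem IsThin.setLIntegral_farKernel_inter_Ici_le (hα : -1 / 2 ≤ α) (hS : IsThin ε α S)
    (hSm : MeasurableSet S) (hδ : 0 < δ) (hx : 0 ≤ x) :
    ∫⁻ y in S ∩ Ici 2, farKernel α δ x y ∂mu α ≤ ENNReal.ofReal ε *
      (ENNReal.ofReal (harnackConst α δ) * ENNReal.ofReal (rowConst α / (1 / 2))) := by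
  refine (hS.setLIntegral_inter_Ici_le hSm fun a ha y hy y' hy' =>
    farKernel_le_harnackConst_mul hα hδ hx ha hy hy').trans ?_
  rw [lintegral_const_mul _ (by fun_prop)]
  gcongr
  exact lintegral_scaledKernel_le hα two_pos one_half_pos x

/-- The factor of `ε` in the bound for the rows of the far kernel over an `(ε, α)`-thin set: the
first term comes from `[0, 2]`, the second one from `[2, ∞)`. -/
def thinConst (α δ : ℝ) : ℝ≥0∞ :=
  ENNReal.ofReal (j α 0 * (4 / δ) ^ (α + 1)) * (mu α (Icc 0 1) + mu α (Icc 1 2)) +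
    ENNReal.ofReal (harnackConst α δ) * ENNReal.ofReal (rowConst α / (1 / 2))

theorem thinConst_ne_top (hα : -1 / 2 ≤ α) (δ : ℝ) : thinConst α δ ≠ ∞ := by
  have := isLocallyFiniteMeasure_mu hα
  have h01 : mu α (Icc 0 1) ≠ ∞ := isCompact_Icc.measure_ne_top
  have h12 : mu α (Icc 1 2) ≠ ∞ := isCompact_Icc.measure_ne_top
  unfold thinConst
  finiteness

theorem IsThin.setLIntegral_farKernel_le (hα : -1 / 2 ≤ α) (hS : IsThin ε α S)
    (hSm : MeasurableSet S) (hS0 : S ⊆ Ici 0) (hδ : 0 < δ) (hx : 0 ≤ x) :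
    ∫⁻ y in S, farKernel α δ x y ∂mu α ≤ ENNReal.ofReal ε * thinConst α δ := by
  have hsplit : S = S ∩ Icc 0 2 ∪ S ∩ Ici 2 := by
    rw [← inter_union_distrib_left, Icc_union_Ici_eq_Ici zero_le_two, inter_eq_left.2 hS0]
  calc _ ≤ (∫⁻ y in S ∩ Icc 0 2, farKernel α δ x y ∂mu α) +
        ∫⁻ y in S ∩ Ici 2, farKernel α δ x y ∂mu α := by
        conv_lhs => rw [hsplit]
        exact lintegral_union_le _ _ _
    _ ≤ _ := by
        rw [thinConst, mul_add]
        exact add_le_add (hS.setLIntegral_farKernel_inter_Icc_le hα hSm hδ hx)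
          (hS.setLIntegral_farKernel_inter_Ici_le hα hSm hδ hx)

theorem IsThin.setLIntegral_cutoffKernel_le (hα : -1 / 2 ≤ α) (hS : IsThin ε α S)
    (hSm : MeasurableSet S) (hS0 : S ⊆ Ici 0) (hδ : 0 < δ) (hx : 0 ≤ x) :
    ∫⁻ y in S, cutoffKernel α x y ∂mu α ≤
      ENNReal.ofReal (exp π * π * (rowConst α * δ)) + ENNReal.ofReal ε * thinConst α δ := by
  calc _ ≤ ∫⁻ y in S, (ENNReal.ofReal (exp π * π) * scaledKernel α 1 (1 / δ) x y +
        farKernel α δ x y) ∂mu α :=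
        lintegral_mono fun y => cutoffKernel_le_add_farKernel (by linarith) hδ x y
    _ = ENNReal.ofReal (exp π * π) * (∫⁻ y in S, scaledKernel α 1 (1 / δ) x y ∂mu α) +
        ∫⁻ y in S, farKernel α δ x y ∂mu α := by
        rw [lintegral_add_left (by fun_prop), lintegral_const_mul _ (by fun_prop)]
    _ ≤ _ := by
        refine add_le_add ?_ (hS.setLIntegral_farKernel_le hα hSm hS0 hδ hx)
        rw [ENNReal.ofReal_mul (p := exp π * π) (by positivity)]
        gcongr
        refine (setLIntegral_le_lintegral _ _).trans
          ((lintegral_scaledKernel_le hα one_pos (by positivity) x).trans_eq ?_)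
        rw [div_div_eq_mul_div, div_one]

theorem exists_isThin_setLIntegral_cutoffKernel_le (hα : -1 / 2 ≤ α) {η : ℝ} (hη : 0 < η) :
    ∃ ε > 0, ∀ S : Set ℝ, IsThin ε α S → MeasurableSet S → S ⊆ Ici 0 → ∀ x, 0 ≤ x →
      ∫⁻ y in S, cutoffKernel α x y ∂mu α ≤ ENNReal.ofReal η := by
  have hrow := rowConst_pos (by linarith : -1 < α)
  set δ := η / 2 / (exp π * π * rowConst α) with hδ
  have near_eq : exp π * π * (rowConst α * δ) = η / 2 := by rw [hδ]; field_simp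
  obtain ⟨ε, hε, far_lt⟩ := ENNReal.exists_nnreal_pos_mul_lt (thinConst_ne_top hα δ)
    (ENNReal.ofReal_pos.2 (half_pos hη)).ne'
  refine ⟨ε, hε, fun S hS hSm hS0 x hx => ?_⟩
  calc _ ≤ ENNReal.ofReal (η / 2) + ENNReal.ofReal ε * thinConst α δ :=
        near_eq ▸ hS.setLIntegral_cutoffKernel_le hα hSm hS0 (by positivity) hx
    _ ≤ ENNReal.ofReal (η / 2) + ENNReal.ofReal (η / 2) := by
        rw [ENNReal.ofReal_coe_nnreal]
        gcongr
    _ = ENNReal.ofReal η := by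
        rw [← ENNReal.ofReal_add (by positivity) (by positivity), add_halves]

end ThinSets

/-! ### The two cutoffs add up to the identity -/

section PhaseSpace

variable {α s a b : ℝ} {f g : ℝ → ℂ} {u v : ℝ → ℝ}

/-- The quadratic form of the slice of the cutoff kernel at time `s`. -/
def sliceForm (α s : ℝ) (u : ℝ → ℝ≥0∞) : ℝ≥0∞ :=
  ∫⁻ p, cutoffSlice α s p.1 p.2 * (u p.1 * u p.2) ∂(mu α).prod (mu α)

/-- The quadratic form of the cutoff kernel. -/
def cutoffForm (α : ℝ) (u : ℝ → ℝ≥0∞) : ℝ≥0∞ :=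
  ∫⁻ p, cutoffKernel α p.1 p.2 * (u p.1 * u p.2) ∂(mu α).prod (mu α)

theorem measurable_sliceForm (α : ℝ) {u : ℝ → ℝ≥0∞} (hu : Measurable u) :
    Measurable fun s => sliceForm α s u :=
  Measurable.lintegral_prod_right' (f := fun q : ℝ × ℝ × ℝ =>
    cutoffSlice α q.1 q.2.1 q.2.2 * (u q.2.1 * u q.2.2)) (by fun_prop)

theorem lintegral_sliceForm (α : ℝ) {u : ℝ → ℝ≥0∞} (hu : Measurable u) :
    ∫⁻ s in Ioi 0, sliceForm α s u = cutoffForm α u := by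
  unfold sliceForm cutoffForm
  rw [lintegral_lintegral_swap (by fun_prop)]
  refine lintegral_congr fun p => ?_
  rw [lintegral_mul_const _ (by fun_prop), cutoffKernel]

theorem enorm_ofReal_of_nonneg {r : ℝ} (hr : 0 ≤ r) : ‖(r : ℂ)‖ₑ = ENNReal.ofReal r := by
  rw [← ofReal_norm, Complex.norm_of_nonneg hr]

theorem integrable_heat (hα : -1 < α) (hs : 0 < s) (x : ℝ) : Integrable (heat α s x) (mu α) :=
  integrable_of_integral_eq_one (integral_heat hα hs x)

theorem pi_mul_sq_mul_gauss_le (hs : 0 < s) (x : ℝ) : π * (x ^ 2 * gauss s x) ≤ 1 / s := by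
  rw [le_div_iff₀ hs, gauss, neg_mul]
  linarith [mul_exp_neg_le_one (π * s * x ^ 2)]

theorem integrable_pi_mul_sq_mul_gauss (hα : -1 < α) (hs : 0 < s) :
    Integrable (fun x => π * (x ^ 2 * gauss s x)) (mu α) :=
  (integrable_pow_mul_exp hα (by positivity : 0 < π * s) 1).const_mul π

theorem integrable_gauss_mul (hs : 0 < s) (hf : Integrable f (mu α)) :
    Integrable (fun x => (gauss s x : ℂ) * f x) (mu α) := by
  refine hf.bdd_mul (c := 1) (by fun_prop) (Eventually.of_forall fun x => ?_)
  rw [Complex.norm_of_nonneg (gauss_pos s x).le]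
  exact gauss_le_one hs.le x

theorem integrable_pi_mul_sq_mul_gauss_mul (hs : 0 < s) (hf : Integrable f (mu α)) :
    Integrable (fun x => ((π * (x ^ 2 * gauss s x) : ℝ) : ℂ) * f x) (mu α) := by
  refine hf.bdd_mul (c := 1 / s) (by fun_prop) (Eventually.of_forall fun x => ?_)
  have := gauss_pos s x
  rw [Complex.norm_of_nonneg (by positivity)]
  exact pi_mul_sq_mul_gauss_le hs x

theorem transform_gauss_mul (hα : -1 / 2 ≤ α) (hs : 0 < s) (hf : Integrable f (mu α)) (ξ : ℝ) :
    transform α (fun x => (gauss s x : ℂ) * f x) ξ =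
      ∫ η, (heat α s ξ η : ℂ) * transform α f η ∂mu α := by
  have hint : Integrable (Function.uncurry fun x η : ℝ =>
      (heat α s ξ η : ℂ) * (f x * (j α (2 * π * x * η) : ℂ))) ((mu α).prod (mu α)) := by
    have hheat : Integrable (fun η => (heat α s ξ η : ℂ)) (mu α) :=
      (integrable_heat (by linarith) hs ξ).ofReal
    refine ((hf.mul_prod hheat).mul_bdd (c := j α 0)
      (g := fun p : ℝ × ℝ => (j α (2 * π * p.1 * p.2) : ℂ)) (by fun_prop)
      (Eventually.of_forall fun _ => norm_ofReal_j_le hα _)).congr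
      (Eventually.of_forall fun p => ?_)
    simp only [Function.uncurry]
    ring
  have heat_flow (x : ℝ) : ∫ η, (heat α s ξ η : ℂ) * (f x * (j α (2 * π * x * η) : ℂ)) ∂mu α =
      gauss s x * f x * (j α (2 * π * x * ξ) : ℂ) := by
    have h := integral_heat_mul_j (by linarith : -1 < α) hs ξ x
    simp only [mul_right_comm (2 * π) _ x] at h
    calc _ = ∫ η, ((heat α s ξ η * j α (2 * π * x * η) : ℝ) : ℂ) * f x ∂mu α := by
          congr 1
          ext η
          push_cast
          ring
      _ = _ := by
          rw [integral_mul_const, integral_complex_ofReal, h]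
          push_cast
          ring
  simp only [transform, ← integral_const_mul]
  rw [← integral_integral_swap hint]
  simp only [heat_flow]

theorem enorm_integral_gauss_mul_transform_le (hα : -1 / 2 ≤ α) (hs : 0 < s)
    (hf : Integrable f (mu α)) :
    ‖∫ ξ, (gauss s ξ : ℂ) * (transform α f ξ *
      conj (transform α (fun x => ((π * (x ^ 2 * gauss s x) : ℝ) : ℂ) * f x) ξ)) ∂mu α‖ₑ ≤
      sliceForm α s fun x => ‖f x‖ₑ := by
  rw [integral_gauss_mul_transform_mul_conj hα hs hf (integrable_pi_mul_sq_mul_gauss_mul hs hf)]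
  refine (enorm_integral_le_lintegral_enorm _).trans_eq (lintegral_congr fun p => ?_)
  have := gauss_pos s p.2
  have hheat := heat_pos (by linarith : -1 < α) hs p.1 p.2
  rw [enorm_mul, enorm_mul, map_mul, enorm_mul, Complex.conj_ofReal, RCLike.enorm_conj,
    enorm_ofReal_of_nonneg hheat.le, enorm_ofReal_of_nonneg (by positivity), cutoffSlice,
    ENNReal.ofReal_mul hheat.le]
  ring

theorem enorm_integral_pi_mul_sq_mul_gauss_mul_transform_le (hα : -1 / 2 ≤ α) (hs : 0 < s)
    (hf : Integrable f (mu α)) :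
    ‖∫ ξ, ((π * (ξ ^ 2 * gauss s ξ) : ℝ) : ℂ) * (transform α f ξ *
      conj (transform α (fun x => (gauss s x : ℂ) * f x) ξ)) ∂mu α‖ₑ ≤
      sliceForm α s fun x => ‖transform α f x‖ₑ := by
  have := measurable_transform hf.aestronglyMeasurable
  rw [sliceForm, lintegral_prod_symm _ (by fun_prop)]
  refine (enorm_integral_le_lintegral_enorm _).trans (lintegral_mono fun ξ => ?_)
  have := gauss_pos s ξ
  rw [enorm_mul, enorm_mul, RCLike.enorm_conj, transform_gauss_mul hα hs hf,
    enorm_ofReal_of_nonneg (by positivity), ← mul_assoc]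
  calc _ ≤ ENNReal.ofReal (π * (ξ ^ 2 * gauss s ξ)) * ‖transform α f ξ‖ₑ *
        ∫⁻ η, ‖(heat α s ξ η : ℂ) * transform α f η‖ₑ ∂mu α := by
        gcongr
        exact enorm_integral_le_lintegral_enorm _
    _ = _ := by
        rw [← lintegral_const_mul' _ _ (by finiteness)]
        refine lintegral_congr fun η => ?_
        have hheat := heat_pos (by linarith : -1 < α) hs ξ η
        rw [enorm_mul, enorm_ofReal_of_nonneg hheat.le, cutoffSlice, heat_comm α s η ξ,
          ENNReal.ofReal_mul hheat.le]
        ring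

/-- The Rihaczek distribution of `f`, a complex density on phase space; the first coordinate is the
frequency. -/
def rihaczek (α : ℝ) (f : ℝ → ℂ) (p : ℝ × ℝ) : ℂ :=
  transform α f p.1 * (conj (f p.2) * (j α (2 * π * p.2 * p.1) : ℂ))

theorem measurable_rihaczek (hfm : Measurable f) : Measurable (rihaczek α f) := by
  have := measurable_transform (α := α) hfm.aestronglyMeasurable
  have : Measurable fun x => conj (f x) := Complex.continuous_conj.measurable.comp hfm
  unfold rihaczek
  fun_prop

theorem ofReal_mul_rihaczek_eq (u v : ℝ → ℝ) (p : ℝ × ℝ) :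
    ((u p.1 * v p.2 : ℝ) : ℂ) * rihaczek α f p = (u p.1 * transform α f p.1) *
      (conj (v p.2 * f p.2) * (j α (2 * π * p.2 * p.1) : ℂ)) := by
  rw [rihaczek, map_mul, Complex.conj_ofReal]
  push_cast
  ring

theorem integrable_mul_rihaczek (hα : -1 / 2 ≤ α) (hf : Integrable f (mu α))
    (hu : Integrable u (mu α)) (hv : Integrable (fun x => (v x : ℂ) * f x) (mu α)) :
    Integrable (fun p => ((u p.1 * v p.2 : ℝ) : ℂ) * rihaczek α f p) ((mu α).prod (mu α)) := by
  have hu' : Integrable (fun ξ => (u ξ : ℂ) * transform α f ξ) (mu α) :=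
    hu.ofReal.mul_bdd (measurable_transform hf.aestronglyMeasurable).aestronglyMeasurable
      (Eventually.of_forall fun ξ => norm_transform_le hα hf ξ)
  simp only [ofReal_mul_rihaczek_eq, ← mul_assoc]
  exact (hu'.mul_prod (integrable_conj hv)).mul_bdd (c := j α 0) (by fun_prop)
    (Eventually.of_forall fun _ => norm_ofReal_j_le hα _)

theorem integral_mul_rihaczek (hα : -1 / 2 ≤ α) (hf : Integrable f (mu α))
    (hu : Integrable u (mu α)) (hv : Integrable (fun x => (v x : ℂ) * f x) (mu α)) :
    ∫ p, ((u p.1 * v p.2 : ℝ) : ℂ) * rihaczek α f p ∂(mu α).prod (mu α) =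
      ∫ ξ, (u ξ : ℂ) * (transform α f ξ * conj (transform α (fun x => (v x : ℂ) * f x) ξ))
        ∂mu α := by
  have hint := integrable_mul_rihaczek hα hf hu hv
  simp only [ofReal_mul_rihaczek_eq] at hint ⊢
  rw [integral_prod _ hint]
  simp only [integral_const_mul, conj_transform]
  simp only [transform, mul_assoc]

/-- The Gaussian weight on phase space. -/
def phaseWeight (s : ℝ) (p : ℝ × ℝ) : ℝ := gauss s p.1 * gauss s p.2

/-- Minus the derivative of the Gaussian weight in `s`. -/
def phaseWeightDeriv (s : ℝ) (p : ℝ × ℝ) : ℝ :=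
  gauss s p.1 * (π * (p.2 ^ 2 * gauss s p.2)) + π * (p.1 ^ 2 * gauss s p.1) * gauss s p.2

theorem phaseWeight_nonneg (s : ℝ) (p : ℝ × ℝ) : 0 ≤ phaseWeight s p :=
  mul_nonneg (gauss_pos _ _).le (gauss_pos _ _).le

theorem phaseWeightDeriv_nonneg (s : ℝ) (p : ℝ × ℝ) : 0 ≤ phaseWeightDeriv s p := by
  have := gauss_pos s p.1
  have := gauss_pos s p.2
  unfold phaseWeightDeriv
  positivity

theorem gauss_le_gauss (hab : a ≤ b) (x : ℝ) : gauss b x ≤ gauss a x := by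
  unfold gauss
  gcongr

theorem phaseWeight_le_phaseWeight (hab : a ≤ b) (p : ℝ × ℝ) : phaseWeight b p ≤ phaseWeight a p :=
  mul_le_mul (gauss_le_gauss hab _) (gauss_le_gauss hab _) (gauss_pos _ _).le (gauss_pos _ _).le

theorem phaseWeightDeriv_le_phaseWeightDeriv (hab : a ≤ b) (p : ℝ × ℝ) :
    phaseWeightDeriv b p ≤ phaseWeightDeriv a p := by
  have h1 := gauss_le_gauss hab p.1
  have h2 := gauss_le_gauss hab p.2
  have := gauss_pos b p.1
  have := gauss_pos b p.2
  have := gauss_pos a p.1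
  have := gauss_pos a p.2
  unfold phaseWeightDeriv
  gcongr

theorem hasDerivAt_gauss (s x : ℝ) :
    HasDerivAt (fun s => gauss s x) (-(π * (x ^ 2 * gauss s x))) s := by
  have hexponent : HasDerivAt (fun s => -(π * s) * x ^ 2) (-π * x ^ 2) s := by
    simpa using (((hasDerivAt_id' s).const_mul π).neg.mul_const (x ^ 2))
  convert! hexponent.exp using 1
  rw [gauss]
  ring

theorem integral_Ioc_phaseWeightDeriv (hab : a ≤ b) (p : ℝ × ℝ) :
    ∫ s in Ioc a b, phaseWeightDeriv s p = phaseWeight a p - phaseWeight b p := by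
  have hderiv (s : ℝ) : HasDerivAt (fun s => -phaseWeight s p) (phaseWeightDeriv s p) s := by
    convert! ((hasDerivAt_gauss s p.1).mul (hasDerivAt_gauss s p.2)).neg using 1
    rw [phaseWeightDeriv]
    ring
  rw [← intervalIntegral.integral_of_le hab, intervalIntegral.integral_eq_sub_of_hasDerivAt
    (fun s _ => hderiv s)]
  · ring
  · refine Continuous.intervalIntegrable ?_ _ _
    unfold phaseWeightDeriv gauss
    fun_prop

theorem integrable_phaseWeight_mul_rihaczek (hα : -1 / 2 ≤ α) (hs : 0 < s)
    (hf : Integrable f (mu α)) :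
    Integrable (fun p => (phaseWeight s p : ℂ) * rihaczek α f p) ((mu α).prod (mu α)) :=
  integrable_mul_rihaczek hα hf (integrable_gauss (by linarith) hs) (integrable_gauss_mul hs hf)

theorem integrable_phaseWeightDeriv_mul_rihaczek (hα : -1 / 2 ≤ α) (hs : 0 < s)
    (hf : Integrable f (mu α)) :
    Integrable (fun p => (phaseWeightDeriv s p : ℂ) * rihaczek α f p) ((mu α).prod (mu α)) := by
  have hα' : -1 < α := by linarith
  simp only [phaseWeightDeriv, Complex.ofReal_add, add_mul]
  exact (integrable_mul_rihaczek hα hf (integrable_gauss hα' hs)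
    (integrable_pi_mul_sq_mul_gauss_mul hs hf)).add (integrable_mul_rihaczek hα hf
      (integrable_pi_mul_sq_mul_gauss hα' hs) (integrable_gauss_mul hs hf))

theorem enorm_integral_phaseWeightDeriv_mul_rihaczek_le (hα : -1 / 2 ≤ α) (hs : 0 < s)
    (hf : Integrable f (mu α)) :
    ‖∫ p, (phaseWeightDeriv s p : ℂ) * rihaczek α f p ∂(mu α).prod (mu α)‖ₑ ≤
      sliceForm α s (fun x => ‖f x‖ₑ) + sliceForm α s fun x => ‖transform α f x‖ₑ := by
  have hα' : -1 < α := by linarith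
  have hgauss := integrable_gauss hα' hs
  have hsq := integrable_pi_mul_sq_mul_gauss hα' hs
  have hgauss' := integrable_gauss_mul hs hf
  have hsq' := integrable_pi_mul_sq_mul_gauss_mul hs hf
  simp only [phaseWeightDeriv, Complex.ofReal_add, add_mul]
  rw [integral_add (integrable_mul_rihaczek hα hf hgauss hsq')
    (integrable_mul_rihaczek hα hf hsq hgauss'), integral_mul_rihaczek hα hf hgauss hsq',
    integral_mul_rihaczek hα hf hsq hgauss']
  exact (enorm_add_le _ _).trans (add_le_add (enorm_integral_gauss_mul_transform_le hα hs hf)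
    (enorm_integral_pi_mul_sq_mul_gauss_mul_transform_le hα hs hf))

/-- The pairing of `e_s 𝓕 f` with `𝓕 (e_s f)`, for the Gaussian `e_s`, as an integral over phase
space. -/
def gaussPairing (α : ℝ) (f : ℝ → ℂ) (s : ℝ) : ℂ :=
  ∫ p, (phaseWeight s p : ℂ) * rihaczek α f p ∂(mu α).prod (mu α)

theorem gaussPairing_eq (hα : -1 / 2 ≤ α) (hs : 0 < s) (hf : Integrable f (mu α)) :
    gaussPairing α f s = ∫ ξ, (gauss s ξ : ℂ) * (transform α f ξ *
      conj (transform α (fun x => (gauss s x : ℂ) * f x) ξ)) ∂mu α :=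
  integral_mul_rihaczek hα hf (integrable_gauss (by linarith) hs) (integrable_gauss_mul hs hf)

theorem integrable_strip_phaseWeightDeriv_mul_rihaczek (hα : -1 / 2 ≤ α) (hfm : Measurable f)
    (hf : Integrable f (mu α)) (ha : 0 < a) (b : ℝ) :
    Integrable (Function.uncurry fun s p => (phaseWeightDeriv s p : ℂ) * rihaczek α f p)
      ((volume.restrict (Ioc a b)).prod ((mu α).prod (mu α))) := by
  have := measurable_rihaczek (α := α) hfm
  have hdom : Integrable (fun q : ℝ × ℝ × ℝ =>
      (1 : ℝ) * ‖(phaseWeightDeriv a q.2 : ℂ) * rihaczek α f q.2‖)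
      ((volume.restrict (Ioc a b)).prod ((mu α).prod (mu α))) :=
    (integrable_const (1 : ℝ)).mul_prod (integrable_phaseWeightDeriv_mul_rihaczek hα ha hf).norm
  have hae : ∀ᵐ q ∂(volume.restrict (Ioc a b)).prod ((mu α).prod (mu α)), q.1 ∈ Ioc a b :=
    Measure.quasiMeasurePreserving_fst.ae (ae_restrict_mem measurableSet_Ioc)
  refine hdom.mono' (by unfold Function.uncurry phaseWeightDeriv; fun_prop) ?_
  filter_upwards [hae] with q hq
  rw [one_mul, Function.uncurry, norm_mul, norm_mul, Complex.norm_of_nonneg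
    (phaseWeightDeriv_nonneg _ _), Complex.norm_of_nonneg (phaseWeightDeriv_nonneg _ _)]
  gcongr
  exact phaseWeightDeriv_le_phaseWeightDeriv hq.1.le _

theorem gaussPairing_sub_eq (hα : -1 / 2 ≤ α) (hfm : Measurable f) (hf : Integrable f (mu α))
    (ha : 0 < a) (hab : a ≤ b) :
    gaussPairing α f a - gaussPairing α f b =
      ∫ s in Ioc a b, ∫ p, (phaseWeightDeriv s p : ℂ) * rihaczek α f p ∂(mu α).prod (mu α) := by
  rw [integral_integral_swap (integrable_strip_phaseWeightDeriv_mul_rihaczek hα hfm hf ha b),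
    gaussPairing, gaussPairing, ← integral_sub (integrable_phaseWeight_mul_rihaczek hα ha hf)
    (integrable_phaseWeight_mul_rihaczek hα (ha.trans_le hab) hf)]
  congr 1
  ext p
  rw [integral_mul_const, integral_complex_ofReal, integral_Ioc_phaseWeightDeriv hab,
    Complex.ofReal_sub, sub_mul]

theorem enorm_gaussPairing_sub_le (hα : -1 / 2 ≤ α) (hfm : Measurable f)
    (hf : Integrable f (mu α)) (ha : 0 < a) (hab : a ≤ b) :
    ‖gaussPairing α f a - gaussPairing α f b‖ₑ ≤
      cutoffForm α (fun x => ‖f x‖ₑ) + cutoffForm α fun x => ‖transform α f x‖ₑ := by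
  have := measurable_transform hf.aestronglyMeasurable
  rw [gaussPairing_sub_eq hα hfm hf ha hab]
  calc _ ≤ ∫⁻ s in Ioc a b,
        ‖∫ p, (phaseWeightDeriv s p : ℂ) * rihaczek α f p ∂(mu α).prod (mu α)‖ₑ :=
        enorm_integral_le_lintegral_enorm _
    _ ≤ ∫⁻ s in Ioc a b, (sliceForm α s (fun x => ‖f x‖ₑ) +
          sliceForm α s fun x => ‖transform α f x‖ₑ) :=
        setLIntegral_mono' measurableSet_Ioc fun s hs =>
          enorm_integral_phaseWeightDeriv_mul_rihaczek_le hα (ha.trans hs.1) hf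
    _ ≤ ∫⁻ s in Ioi 0, (sliceForm α s (fun x => ‖f x‖ₑ) +
          sliceForm α s fun x => ‖transform α f x‖ₑ) :=
        lintegral_mono_set fun s hs => ha.trans hs.1
    _ = _ := by
        rw [lintegral_add_left (measurable_sliceForm α (by fun_prop)),
          lintegral_sliceForm α (by fun_prop), lintegral_sliceForm α (by fun_prop)]

theorem tendsto_gauss_atTop {x : ℝ} (hx : x ≠ 0) : Tendsto (fun s => gauss s x) atTop (𝓝 0) := by
  have : Tendsto (fun s : ℝ => -(π * x ^ 2) * s) atTop atBot :=
    tendsto_id.const_mul_atTop_of_neg (neg_lt_zero.2 (by positivity))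
  refine (tendsto_exp_atBot.comp this).congr fun s => ?_
  simp only [Function.comp_apply, gauss]
  ring_nf

theorem tendsto_gaussPairing_atTop (hα : -1 / 2 ≤ α) (hf : Integrable f (mu α)) :
    Tendsto (gaussPairing α f) atTop (𝓝 0) := by
  rw [show (0 : ℂ) = ∫ _ : ℝ × ℝ, (0 : ℂ) ∂(mu α).prod (mu α) by simp]
  refine tendsto_integral_filter_of_dominated_convergence _ ?_ ?_
    (integrable_phaseWeight_mul_rihaczek hα one_pos hf).norm ?_
  · filter_upwards [eventually_gt_atTop 0] with s hs
    exact (integrable_phaseWeight_mul_rihaczek hα hs hf).aestronglyMeasurable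
  · filter_upwards [eventually_ge_atTop 1] with s hs
    refine Eventually.of_forall fun p => ?_
    rw [norm_mul, norm_mul, Complex.norm_of_nonneg (phaseWeight_nonneg _ _),
      Complex.norm_of_nonneg (phaseWeight_nonneg _ _)]
    gcongr
    exact phaseWeight_le_phaseWeight hs p
  · filter_upwards [ae_mu_prod_pos α] with p hp
    have weight_tendsto : Tendsto (fun s => phaseWeight s p) atTop (𝓝 0) := by
      simpa only [phaseWeight, mul_zero] using
        (tendsto_gauss_atTop hp.1.ne').mul (tendsto_gauss_atTop hp.2.ne')
    simpa using weight_tendsto.ofReal.mul_const (rihaczek α f p)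

theorem enorm_gaussPairing_le (hα : -1 / 2 ≤ α) (hfm : Measurable f) (hf : Integrable f (mu α))
    (hs : 0 < s) :
    ‖gaussPairing α f s‖ₑ ≤
      cutoffForm α (fun x => ‖f x‖ₑ) + cutoffForm α fun x => ‖transform α f x‖ₑ := by
  have hlim : Tendsto (fun b => gaussPairing α f s - gaussPairing α f b) atTop
      (𝓝 (gaussPairing α f s)) := by
    simpa using (tendsto_gaussPairing_atTop hα hf).const_sub (gaussPairing α f s)
  refine le_of_tendsto hlim.enorm ?_
  filter_upwards [eventually_ge_atTop s] with b hb
  exact enorm_gaussPairing_sub_le hα hfm hf hs hb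

theorem integrable_gauss_mul_transform_mul_conj (hα : -1 / 2 ≤ α) (hs : 0 < s)
    (hf : Integrable f (mu α)) (hg : Integrable g (mu α)) :
    Integrable (fun ξ => (gauss s ξ : ℂ) * (transform α f ξ * conj (transform α g ξ)))
      (mu α) := by
  have := measurable_transform hf.aestronglyMeasurable
  have := measurable_transform (integrable_conj hg).aestronglyMeasurable
  simp only [conj_transform]
  refine (integrable_gauss (by linarith) hs).ofReal.mul_bdd
    (c := (j α 0 * ∫ x, ‖f x‖ ∂mu α) * (j α 0 * ∫ x, ‖conj (g x)‖ ∂mu α)) (by fun_prop)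
    (Eventually.of_forall fun ξ => ?_)
  rw [norm_mul]
  have hf' := norm_transform_le hα hf ξ
  exact mul_le_mul hf' (norm_transform_le hα (integrable_conj hg) ξ) (norm_nonneg _)
    ((norm_nonneg _).trans hf')

theorem ofReal_integral_gauss_mul_norm_transform_sq_eq_add (hα : -1 / 2 ≤ α) (hs : 0 < s)
    (hf : Integrable f (mu α)) :
    ((∫ ξ, gauss s ξ * ‖transform α f ξ‖ ^ 2 ∂mu α : ℝ) : ℂ) = gaussPairing α f s +
      ∫ ξ, (gauss s ξ : ℂ) * (transform α f ξ *
        conj (transform α (f - fun x => (gauss s x : ℂ) * f x) ξ)) ∂mu α := by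
  have hgf := integrable_gauss_mul hs hf
  rw [gaussPairing_eq hα hs hf, ← integral_add
    (integrable_gauss_mul_transform_mul_conj hα hs hf hgf)
    (integrable_gauss_mul_transform_mul_conj hα hs hf (hf.sub hgf)), ← integral_complex_ofReal]
  congr 1
  ext ξ
  rw [transform_sub hα hf hgf, Pi.sub_apply, map_sub]
  push_cast
  rw [← Complex.mul_conj']
  ring

theorem lintegral_enorm_transform_mul_enorm_transform_le (hα : -1 / 2 ≤ α)
    (hf : Integrable f (mu α)) (hf2 : MemLp f 2 (mu α)) (hg : Integrable g (mu α))
    (hg2 : MemLp g 2 (mu α)) :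
    ∫⁻ ξ, ‖transform α f ξ‖ₑ * ‖transform α g ξ‖ₑ ∂mu α ≤
      eLpNorm f 2 (mu α) * eLpNorm g 2 (mu α) := by
  have hholder := eLpNorm_smul_le_mul_eLpNorm (p := 2) (q := 2) (r := 1)
    (memLp_transform hα hg hg2).aestronglyMeasurable
    (memLp_transform hα hf hf2).aestronglyMeasurable
  simpa only [eLpNorm_one_eq_lintegral_enorm, smul_eq_mul, Pi.mul_apply, enorm_mul,
    eLpNorm_transform hα hf hf2, eLpNorm_transform hα hg hg2] using hholder

theorem memLp_gauss_mul (hs : 0 < s) (hf2 : MemLp f 2 (mu α)) :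
    MemLp (fun x => (gauss s x : ℂ) * f x) 2 (mu α) := by
  refine hf2.of_le (by have := hf2.1; fun_prop) (Eventually.of_forall fun x => ?_)
  rw [norm_mul, Complex.norm_of_nonneg (gauss_pos s x).le]
  exact mul_le_of_le_one_left (norm_nonneg _) (gauss_le_one hs.le x)

theorem lintegral_gauss_mul_enorm_transform_sq_le (hα : -1 / 2 ≤ α) (hs : 0 < s)
    (hf : Integrable f (mu α)) (hf2 : MemLp f 2 (mu α)) :
    ∫⁻ ξ, ENNReal.ofReal (gauss s ξ) * ‖transform α f ξ‖ₑ ^ 2 ∂mu α ≤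
      ‖gaussPairing α f s‖ₑ + eLpNorm f 2 (mu α) *
        eLpNorm (f - fun x => (gauss s x : ℂ) * f x) 2 (mu α) := by
  rw [← ofReal_integral_gauss_mul_norm_transform_sq hα hs hf, ← enorm_ofReal_of_nonneg
    (integral_nonneg fun ξ => mul_nonneg (gauss_pos _ _).le (sq_nonneg _)),
    ofReal_integral_gauss_mul_norm_transform_sq_eq_add hα hs hf]
  refine (enorm_add_le _ _).trans (add_le_add le_rfl ?_)
  refine (enorm_integral_le_lintegral_enorm _).trans ((lintegral_mono fun ξ => ?_).trans
    (lintegral_enorm_transform_mul_enorm_transform_le hα hf hf2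
      (hf.sub (integrable_gauss_mul hs hf)) (hf2.sub (memLp_gauss_mul hs hf2))))
  rw [enorm_mul, enorm_mul, RCLike.enorm_conj, enorm_ofReal_of_nonneg (gauss_pos s ξ).le]
  exact mul_le_of_le_one_left' (ENNReal.ofReal_le_one.2 (gauss_le_one hs.le ξ))

theorem tendsto_eLpNorm_sub_gauss_mul (hf2 : MemLp f 2 (mu α)) :
    Tendsto (fun n : ℕ => eLpNorm (f - fun x => (gauss (1 / (n + 1)) x : ℂ) * f x) 2 (mu α)) atTop
      (𝓝 0) := by
  suffices hsq : Tendsto (fun n : ℕ =>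
      eLpNorm (f - fun x => (gauss (1 / (n + 1)) x : ℂ) * f x) 2 (mu α) ^ 2) atTop (𝓝 0) by
    have hsqrt := (ENNReal.continuous_rpow_const (y := 1 / 2)).tendsto 0 |>.comp hsq
    simpa [Function.comp_def, ← ENNReal.rpow_natCast_mul] using hsqrt
  have := hf2.1.aemeasurable
  simp only [eLpNorm_two_sq, Pi.sub_apply, ← one_sub_mul]
  rw [← lintegral_zero (μ := mu α)]
  refine tendsto_lintegral_of_dominated_convergence' (fun x => ‖f x‖ₑ ^ 2) (fun n => by fun_prop)
    (fun n => Eventually.of_forall fun x => ?_) ?_ (Eventually.of_forall fun x => ?_)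
  · dsimp only
    have hpos := gauss_pos (1 / ((n : ℝ) + 1)) x
    have hle := gauss_le_one (by positivity : 0 ≤ 1 / ((n : ℝ) + 1)) x
    rw [enorm_mul, ← Complex.ofReal_one, ← Complex.ofReal_sub, enorm_ofReal_of_nonneg (by linarith)]
    gcongr
    exact mul_le_of_le_one_left' (ENNReal.ofReal_le_one.2 (by linarith))
  · rw [← eLpNorm_two_sq]
    exact ENNReal.pow_ne_top hf2.eLpNorm_ne_top
  · have hcont : Continuous fun s => ‖(1 - (gauss s x : ℂ)) * f x‖ₑ ^ 2 := by
      unfold gauss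
      fun_prop
    simpa [Function.comp_def, gauss] using
      (hcont.tendsto 0).comp tendsto_one_div_add_atTop_nhds_zero_nat

theorem lintegral_enorm_sq_le_cutoffForm (hα : -1 / 2 ≤ α) (hfm : Measurable f)
    (hf : Integrable f (mu α)) (hf2 : MemLp f 2 (mu α)) :
    ∫⁻ x, ‖f x‖ₑ ^ 2 ∂mu α ≤
      cutoffForm α (fun x => ‖f x‖ₑ) + cutoffForm α fun x => ‖transform α f x‖ₑ := by
  have := measurable_transform hf.aestronglyMeasurable
  have lhs_tendsto := tendsto_lintegral_gauss_mul (α := α)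
    (u := fun ξ => ‖transform α f ξ‖ₑ ^ 2) (by fun_prop) (by simp)
  rw [lintegral_enorm_transform_sq hα hfm hf hf2] at lhs_tendsto
  have error_tendsto := ENNReal.Tendsto.const_mul (tendsto_eLpNorm_sub_gauss_mul hf2)
    (Or.inr hf2.eLpNorm_ne_top)
  rw [mul_zero] at error_tendsto
  refine le_of_tendsto_of_tendsto lhs_tendsto
    (by simpa only [add_zero] using error_tendsto.const_add _)
    (Eventually.of_forall fun n => ?_)
  have hs : 0 < 1 / ((n : ℝ) + 1) := by positivity
  exact (lintegral_gauss_mul_enorm_transform_sq_le hα hs hf hf2).trans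
    (add_le_add (enorm_gaussPairing_le hα hfm hf hs) le_rfl)

end PhaseSpace

/-! ### Schur's test, limits of norms and absorption -/

section Schur

variable {X Y E ι : Type*} [MeasurableSpace X] [MeasurableSpace Y] {μ ν : Measure X}
  {μ' : Measure Y} [NormedAddCommGroup E]

theorem mul_le_mul_sq_add_inv_mul_sq {c : ℝ≥0∞} (hc : c ≠ 0) (hc' : c ≠ ∞) (a b : ℝ≥0∞) :
    a * b ≤ c * a ^ 2 + c⁻¹ * b ^ 2 := by
  rcases le_total (c * a) b with hab | hab
  · have hle : a ≤ c⁻¹ * b := by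
      rwa [← ENNReal.div_eq_inv_mul, ENNReal.le_div_iff_mul_le (.inl hc) (.inl hc'), mul_comm]
    calc a * b ≤ c⁻¹ * b * b := by gcongr
      _ = c⁻¹ * b ^ 2 := by ring
      _ ≤ _ := le_add_self
  · calc a * b ≤ a * (c * a) := by gcongr
      _ = c * a ^ 2 := by ring
      _ ≤ _ := le_self_add

theorem lintegral_prod_kernel_mul_le [SFinite μ] [SFinite μ'] {K : X → Y → ℝ≥0∞}
    (hK : Measurable (Function.uncurry K)) {A B : ℝ≥0∞} (hrow : ∀ᵐ x ∂μ, ∫⁻ y, K x y ∂μ' ≤ A)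
    (hcol : ∀ᵐ y ∂μ', ∫⁻ x, K x y ∂μ ≤ B) {u : X → ℝ≥0∞} {v : Y → ℝ≥0∞} (hu : Measurable u)
    (hv : Measurable v) {c : ℝ≥0∞} (hc : c ≠ 0) (hc' : c ≠ ∞) :
    ∫⁻ p, K p.1 p.2 * (u p.1 * v p.2) ∂μ.prod μ' ≤
      c * A * ∫⁻ x, u x ^ 2 ∂μ + c⁻¹ * B * ∫⁻ y, v y ^ 2 ∂μ' := by
  have hK' : Measurable fun p : X × Y => K p.1 p.2 := hK
  calc ∫⁻ p, K p.1 p.2 * (u p.1 * v p.2) ∂μ.prod μ'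
    _ ≤ ∫⁻ p, (K p.1 p.2 * (c * u p.1 ^ 2) + K p.1 p.2 * (c⁻¹ * v p.2 ^ 2)) ∂μ.prod μ' := by
        refine lintegral_mono fun p => ?_
        rw [← mul_add]
        gcongr
        exact mul_le_mul_sq_add_inv_mul_sq hc hc' _ _
    _ = (∫⁻ x, (∫⁻ y, K x y ∂μ') * (c * u x ^ 2) ∂μ) +
          ∫⁻ y, (∫⁻ x, K x y ∂μ) * (c⁻¹ * v y ^ 2) ∂μ' := by
        rw [lintegral_add_left (by fun_prop), lintegral_prod _ (by fun_prop),
          lintegral_prod_symm _ (by fun_prop)]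
        simp only [lintegral_mul_const _ hK.of_uncurry_left,
          lintegral_mul_const _ hK.of_uncurry_right]
    _ ≤ (∫⁻ x, A * (c * u x ^ 2) ∂μ) + ∫⁻ y, B * (c⁻¹ * v y ^ 2) ∂μ' := by
        refine add_le_add (lintegral_mono_ae ?_) (lintegral_mono_ae ?_)
        · filter_upwards [hrow] with x hx using by gcongr
        · filter_upwards [hcol] with y hy using by gcongr
    _ = _ := by
        simp only [← mul_assoc]
        rw [lintegral_const_mul _ (by fun_prop), lintegral_const_mul _ (by fun_prop),
          mul_comm A, mul_comm B]

theorem tendsto_eLpNorm_of_tendsto_eLpNorm_sub {p : ℝ≥0∞} (hp : 1 ≤ p) (hν : ν ≤ μ) {l : Filter ι}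
    {F : ι → X → E} {g : X → E} (hF : ∀ i, AEStronglyMeasurable (F i) μ)
    (hg : AEStronglyMeasurable g μ) (hFg : Tendsto (fun i => eLpNorm (F i - g) p μ) l (𝓝 0)) :
    Tendsto (fun i => eLpNorm (F i) p ν) l (𝓝 (eLpNorm g p ν)) := by
  have hlower : Tendsto (fun i => eLpNorm g p ν - eLpNorm (F i - g) p μ) l
      (𝓝 (eLpNorm g p ν)) := by
    simpa using ENNReal.Tendsto.sub tendsto_const_nhds hFg (.inr ENNReal.zero_ne_top)
  have hupper : Tendsto (fun i => eLpNorm g p ν + eLpNorm (F i - g) p μ) l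
      (𝓝 (eLpNorm g p ν)) := by
    simpa using hFg.const_add (eLpNorm g p ν)
  have hF' (i : ι) := (hF i).mono_measure hν
  have hg' := hg.mono_measure hν
  refine tendsto_of_tendsto_of_tendsto_of_le_of_le hlower hupper (fun i => ?_) fun i => ?_
  · refine tsub_le_iff_right.2 (le_trans ?_ (add_le_add le_rfl (eLpNorm_mono_measure _ hν)))
    simpa only [sub_sub_cancel] using eLpNorm_sub_le (hF' i) ((hF' i).sub hg') hp
  · refine le_trans ?_ (add_le_add le_rfl (eLpNorm_mono_measure _ hν))
    simpa only [add_sub_cancel] using eLpNorm_add_le hg' ((hF' i).sub hg') hp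

theorem le_mul_add_of_sq_le {n a b : ℝ≥0∞} {C : ℝ} (hC : 0 ≤ C) (hn : n ≠ ∞)
    (h : n ^ 2 ≤ ENNReal.ofReal (3 / 8) * n ^ 2 + ENNReal.ofReal C * a ^ 2 +
      (ENNReal.ofReal (3 / 8) * n ^ 2 + ENNReal.ofReal C * b ^ 2)) :
    n ≤ ENNReal.ofReal √(4 * C) * (a + b) := by
  have habsorb : ENNReal.ofReal (1 / 4) * n ^ 2 ≤ ENNReal.ofReal C * (a ^ 2 + b ^ 2) := by
    have hne : ENNReal.ofReal (3 / 4) * n ^ 2 ≠ ∞ := by finiteness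
    refine (ENNReal.add_le_add_iff_left hne).1 ?_
    calc ENNReal.ofReal (3 / 4) * n ^ 2 + ENNReal.ofReal (1 / 4) * n ^ 2 = n ^ 2 := by
          rw [← add_mul, ← ENNReal.ofReal_add (by norm_num) (by norm_num)]
          norm_num
      _ ≤ _ := h
      _ = (ENNReal.ofReal (3 / 8) + ENNReal.ofReal (3 / 8)) * n ^ 2 +
            ENNReal.ofReal C * (a ^ 2 + b ^ 2) := by ring
      _ = _ := by
          rw [← ENNReal.ofReal_add (by norm_num) (by norm_num)]
          norm_num
  refine (ENNReal.pow_le_pow_left_iff two_ne_zero).1 ?_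
  calc n ^ 2 = ENNReal.ofReal 4 * (ENNReal.ofReal (1 / 4) * n ^ 2) := by
        rw [← mul_assoc, ← ENNReal.ofReal_mul (by norm_num)]
        norm_num
    _ ≤ ENNReal.ofReal 4 * (ENNReal.ofReal C * (a + b) ^ 2) := by
        refine mul_le_mul_right (habsorb.trans (mul_le_mul_right ?_ _)) _
        rw [add_sq, add_right_comm]
        exact le_self_add
    _ = _ := by
        rw [mul_pow, ← ENNReal.ofReal_pow (sqrt_nonneg _), sq_sqrt (by positivity), ← mul_assoc,
          ENNReal.ofReal_mul (by norm_num)]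

end Schur

/-! ### The estimate on `L¹ ∩ L²` and its extension to `L²` -/

section Estimate

variable {α ε : ℝ} {S S' T : Set ℝ} {f : ℝ → ℂ} {u : ℝ → ℝ≥0∞}

theorem restrict_mu_compl_eq (α : ℝ) (S : Set ℝ) :
    (mu α).restrict Sᶜ = (mu α).restrict (Ici 0 \ S) := by
  refine Measure.restrict_congr_set ?_
  filter_upwards [ae_mu_pos α] with x hx
  exact propext ⟨fun h => ⟨hx.le, h⟩, fun h => h.2⟩

theorem lintegral_prod_restrict_cutoffKernel_mul_le (hα : -1 < α)
    (hrow : ∀ x, 0 ≤ x → ∫⁻ y in S, cutoffKernel α x y ∂mu α ≤ ENNReal.ofReal (1 / 64))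
    (hu : Measurable u) :
    ∫⁻ p, cutoffKernel α p.1 p.2 * (u p.1 * u p.2) ∂(mu α).prod ((mu α).restrict S) ≤
      ENNReal.ofReal (1 / 4) * ∫⁻ x, u x ^ 2 ∂mu α := by
  have hschur := lintegral_prod_kernel_mul_le (K := cutoffKernel α) (c := ENNReal.ofReal 8)
    (by unfold Function.uncurry; fun_prop) ((ae_mu_pos α).mono fun x hx => hrow x hx.le)
    (Eventually.of_forall (lintegral_cutoffKernel_left_le hα)) hu hu (by simp)
    ENNReal.ofReal_ne_top
  refine hschur.trans ?_
  calc _ ≤ ENNReal.ofReal 8 * ENNReal.ofReal (1 / 64) * (∫⁻ x, u x ^ 2 ∂mu α) +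
        (ENNReal.ofReal 8)⁻¹ * 1 * ∫⁻ x, u x ^ 2 ∂mu α := by
        gcongr
        exact Measure.restrict_le_self
    _ = _ := by
        rw [← add_mul, mul_one, ← ENNReal.ofReal_inv_of_pos (by norm_num),
          ← ENNReal.ofReal_mul (by norm_num), ← ENNReal.ofReal_add (by norm_num) (by norm_num)]
        norm_num

theorem lintegral_prod_restrict_compl_cutoffKernel_mul_le (hα : -1 / 2 ≤ α) (S : Set ℝ)
    (hu : Measurable u) :
    ∫⁻ p, cutoffKernel α p.1 p.2 * (u p.1 * u p.2) ∂(mu α).prod ((mu α).restrict Sᶜ) ≤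
      ENNReal.ofReal (1 / 8) * ∫⁻ x, u x ^ 2 ∂mu α +
        ENNReal.ofReal (8 * (π * rowConst α)) * ∫⁻ x in Sᶜ, u x ^ 2 ∂mu α := by
  have hα' : -1 < α := by linarith
  have := rowConst_pos hα'
  have hschur := lintegral_prod_kernel_mul_le (K := cutoffKernel α) (μ := mu α)
    (μ' := (mu α).restrict Sᶜ) (c := ENNReal.ofReal (1 / (8 * (π * rowConst α))))
    (by unfold Function.uncurry; fun_prop) (Eventually.of_forall fun x =>
      (setLIntegral_le_lintegral _ _).trans (lintegral_cutoffKernel_right_le hα x))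
    (Eventually.of_forall (lintegral_cutoffKernel_left_le hα')) hu hu
    (ENNReal.ofReal_pos.2 (by positivity)).ne' ENNReal.ofReal_ne_top
  rwa [← ENNReal.ofReal_mul (by positivity), mul_one, ← ENNReal.ofReal_inv_of_pos (by positivity),
    one_div_mul_eq_div, div_mul_cancel_right₀ (by positivity),
    ← one_div, one_div (8 * _), inv_inv] at hschur

theorem cutoffForm_le (hα : -1 / 2 ≤ α) (hS : MeasurableSet S)
    (hrow : ∀ x, 0 ≤ x → ∫⁻ y in S, cutoffKernel α x y ∂mu α ≤ ENNReal.ofReal (1 / 64))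
    (hu : Measurable u) :
    cutoffForm α u ≤ ENNReal.ofReal (3 / 8) * ∫⁻ x, u x ^ 2 ∂mu α +
      ENNReal.ofReal (8 * (π * rowConst α)) * ∫⁻ x in Ici 0 \ S, u x ^ 2 ∂mu α := by
  have hsplit : (mu α).prod (mu α) =
      (mu α).prod ((mu α).restrict S) + (mu α).prod ((mu α).restrict Sᶜ) := by
    rw [← Measure.prod_add, Measure.restrict_add_restrict_compl hS]
  rw [cutoffForm, hsplit, lintegral_add_measure, ← restrict_mu_compl_eq]
  refine (add_le_add (lintegral_prod_restrict_cutoffKernel_mul_le (by linarith) hrow hu)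
    (lintegral_prod_restrict_compl_cutoffKernel_mul_le hα S hu)).trans_eq ?_
  rw [← add_assoc, ← add_mul, ← ENNReal.ofReal_add (by norm_num) (by norm_num)]
  norm_num

theorem eLpNorm_le_of_setLIntegral_cutoffKernel_le (hα : -1 / 2 ≤ α) (hS : MeasurableSet S)
    (hT : MeasurableSet T)
    (hSrow : ∀ x, 0 ≤ x → ∫⁻ y in S, cutoffKernel α x y ∂mu α ≤ ENNReal.ofReal (1 / 64))
    (hTrow : ∀ x, 0 ≤ x → ∫⁻ y in T, cutoffKernel α x y ∂mu α ≤ ENNReal.ofReal (1 / 64))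
    (hfm : Measurable f) (hf : Integrable f (mu α)) (hf2 : MemLp f 2 (mu α)) :
    eLpNorm f 2 (mu α) ≤ ENNReal.ofReal √(4 * (8 * (π * rowConst α))) *
      (eLpNorm f 2 ((mu α).restrict (Ici 0 \ S)) +
        eLpNorm (transform α f) 2 ((mu α).restrict (Ici 0 \ T))) := by
  have := rowConst_pos (by linarith : -1 < α)
  have := measurable_transform hf.aestronglyMeasurable
  have hsum := (lintegral_enorm_sq_le_cutoffForm hα hfm hf hf2).trans (add_le_add
    (cutoffForm_le hα hS hSrow (by fun_prop)) (cutoffForm_le hα hT hTrow (by fun_prop)))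
  simp only [← eLpNorm_two_sq, eLpNorm_transform hα hf hf2] at hsum
  exact le_mul_add_of_sq_le (by positivity) hf2.eLpNorm_ne_top hsum

theorem IsThin.congr_ae (hS : IsThin ε α S) (hSS' : S' =ᵐ[mu α] S) : IsThin ε α S' := by
  have hinter (I : Set ℝ) : mu α (S' ∩ I) = mu α (S ∩ I) :=
    measure_congr (hSS'.inter (ae_eq_refl I))
  simpa only [IsThin, hinter] using hS

theorem exists_measurableSet_ae_eq (α : ℝ) (hS0 : S ⊆ Ici 0) (hS : NullMeasurableSet S) :
    ∃ S', MeasurableSet S' ∧ S' ⊆ Ici 0 ∧ S' =ᵐ[mu α] S := by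
  refine ⟨toMeasurable volume S ∩ Ici 0, (measurableSet_toMeasurable _ _).inter measurableSet_Ici,
    inter_subset_right, ?_⟩
  have hae := ((mu_absolutelyContinuous α).ae_eq hS.toMeasurable_ae_eq).inter
    (ae_eq_refl (Ici (0 : ℝ)))
  rwa [inter_eq_left.2 hS0] at hae

theorem eLpNorm_le_of_forall_mem_L1L2 {A B : Set ℝ} {C : ℝ≥0∞} (hC : C ≠ ∞)
    (hle : ∀ h ∈ L1L2 α, eLpNorm h 2 (mu α) ≤ C * (eLpNorm h 2 ((mu α).restrict A) +
      eLpNorm (transform α h) 2 ((mu α).restrict B))) {f g : L2 α} (hfg : IsTransformL2 α f g) :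
    eLpNorm f 2 (mu α) ≤ C * (eLpNorm f 2 ((mu α).restrict A) +
      eLpNorm g 2 ((mu α).restrict B)) := by
  have : (𝓝[L1L2 α] f).NeBot := mem_closure_iff_nhdsWithin_neBot.1 (dense_L1L2 α f)
  have norm_tendsto {ν : Measure ℝ} (hν : ν ≤ mu α) :
      Tendsto (fun h : L2 α => eLpNorm h 2 ν) (𝓝[L1L2 α] f) (𝓝 (eLpNorm f 2 ν)) := by
    refine tendsto_eLpNorm_of_tendsto_eLpNorm_sub (by norm_num) hν Lp.aestronglyMeasurable
      (Lp.aestronglyMeasurable f) ?_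
    exact (Lp.tendsto_Lp_iff_tendsto_eLpNorm' _ _).1 (tendsto_id.mono_left nhdsWithin_le_nhds)
  have transform_tendsto : Tendsto (fun h : L2 α => eLpNorm (transform α h) 2 ((mu α).restrict B))
      (𝓝[L1L2 α] f) (𝓝 (eLpNorm g 2 ((mu α).restrict B))) :=
    tendsto_eLpNorm_of_tendsto_eLpNorm_sub (by norm_num) Measure.restrict_le_self
      (fun h => (measurable_transform (Lp.aestronglyMeasurable h)).aestronglyMeasurable)
      (Lp.aestronglyMeasurable g) hfg
  exact le_of_tendsto_of_tendsto (norm_tendsto le_rfl) (ENNReal.Tendsto.const_mul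
    ((norm_tendsto Measure.restrict_le_self).add transform_tendsto) (.inr hC))
    (eventually_nhdsWithin_of_forall hle)

end Estimate

end FourierBessel

end

open FourierBessel in
theorem theorem5p3_general (α : ℝ) (hα : -1 / 2 ≤ α) :
    (∀ f : L2 α, IsTransformL2 α f (transformL2 α f)) ∧
    ∃ ε : ℝ, 0 < ε ∧ ∃ C : ℝ, 0 < C ∧ ∀ S T : Set ℝ,
      S ⊆ Ici 0 → NullMeasurableSet S → IsThin ε α S →
      T ⊆ Ici 0 → NullMeasurableSet T → IsThin ε α T →
      ∀ f : L2 α, eLpNorm f 2 (mu α) ≤ ENNReal.ofReal C *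
        (eLpNorm f 2 ((mu α).restrict (Ici 0 \ S)) +
          eLpNorm (transformL2 α f) 2 ((mu α).restrict (Ici 0 \ T))) := by
  have := rowConst_pos (by linarith : -1 < α)
  obtain ⟨ε, hε, hrow⟩ := exists_isThin_setLIntegral_cutoffKernel_le hα
    (by norm_num : (0 : ℝ) < 1 / 64)
  refine ⟨isTransformL2_transformL2 hα, ε, hε, √(4 * (8 * (Real.pi * rowConst α))), by positivity,
    fun S T hS0 hSm hS hT0 hTm hT f => ?_⟩
  obtain ⟨S', hSm', hS0', hSS'⟩ := exists_measurableSet_ae_eq α hS0 hSm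
  obtain ⟨T', hTm', hT0', hTT'⟩ := exists_measurableSet_ae_eq α hT0 hTm
  rw [← Measure.restrict_congr_set ((ae_eq_refl (Ici (0 : ℝ))).diff hSS'),
    ← Measure.restrict_congr_set ((ae_eq_refl (Ici (0 : ℝ))).diff hTT')]
  exact eLpNorm_le_of_forall_mem_L1L2 ENNReal.ofReal_ne_top (fun h hh =>
    eLpNorm_le_of_setLIntegral_cutoffKernel_le hα hSm' hTm' (hrow S' (hS.congr_ae hSS') hSm' hS0')
      (hrow T' (hT.congr_ae hTT') hTm' hT0') (Lp.stronglyMeasurable h).measurable hh (Lp.memLp h))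
    (isTransformL2_transformL2 hα f)


theorem theorem5p3 (α : ℝ) (hα : -1 / 2 < α) :
    (∀ f : FourierBessel.L2 α,
      FourierBessel.IsTransformL2 α f (FourierBessel.transformL2 α f)) ∧
    ∃ ε₀ : ℝ, 0 < ε₀ ∧ ∀ ε : ℝ, 0 < ε → ε < ε₀ →
      ∃ C : ℝ, 0 < C ∧ ∀ S T : Set ℝ,
        S ⊆ Set.Ici 0 → NullMeasurableSet S → FourierBessel.IsThin ε α S →
        T ⊆ Set.Ici 0 → NullMeasurableSet T → FourierBessel.IsThin ε α T →
        ∀ f : FourierBessel.L2 α,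
          eLpNorm f 2 (FourierBessel.mu α) ≤
            ENNReal.ofReal C *
              (eLpNorm f 2 ((FourierBessel.mu α).restrict (Set.Ici 0 \ S)) +
                eLpNorm (FourierBessel.transformL2 α f) 2
                  ((FourierBessel.mu α).restrict (Set.Ici 0 \ T))) := by
  obtain ⟨htransform, ε₀, hε₀, C, hC, hle⟩ := theorem5p3_general α hα.le
  exact ⟨htransform, ε₀, hε₀, fun ε _ hε => ⟨C, hC, fun S T hS0 hSm hS hT0 hTm hT =>
    hle S T hS0 hSm (hS.mono hε.le) hT0 hTm (hT.mono hε.le)⟩⟩
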